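/- **Notation.** $\log$ is the natural logarithm, $\log^{(k)}$ its $k$-fold iterate ($\log^{(0)}n=n$), and $\log^*n$ is the least $k$ with $\log^{(k)}n\le 1$. For $x\to\infty$, $g=\widetilde\Theta(f)$ means that $g$ lies between $c\,f/(\log f)^a$ and $C\,f(\log f)^a$ for some constants $a\in\mathbb N$, $c,C>0$. A clustering of a finite $P\subset\mathbb R^d$ is a partition of $P$ into nonempty clusters; its cost is the maximum over clusters $C$ of the radius $\min_{x\in C}\max_{y\in C}d(x,y)$. For $s>0$, a distribution on functions $f$ on $\mathbb R^d$ is an $(s,R,p_1,p_2)$-LSH family if $\Pr[f(x)=f(y)]\ge p_1$ whenever $d(x,y)\le s$, and $\Pr[f(x)=f(y)]\le p_2$ whenever $d(x,y)\ge R$. **Algorithm Ext-$k$-Center$(P,r)$.** Fix $\rho,\delta\in(0,1)$, $d$, and a constant $c_\rho>1$. The input is a set $P\subset\mathbb R^d$ of $n$ points with pairwise distances at least $1$ and maximum distance $\Delta$, a radius $r>0$, and a precision parameter $\alpha\ge1$. The local space is $S=\lceil\sigma n^\delta\rceil$ for a constant $\sigma>0$. Quantities written $\Theta(\cdot)$ are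 suitable constant multiples (rounded up where integers are needed). All arbitrary choices below are made according to an arbitrary fixed listing of each finite set. * *Nearest-Hub-Search$(Q,H)$*, for hubs $H\subseteq Q$. For $i=1,\dots,\Theta(\log n)$ and $j=0,\dots,\lceil\log_2\Delta\rceil$, draw independently $L=\Theta(n^\rho)$ functions $f_1,\dots,f_L$ from a $(2^j,c_\rho2^j,n^{-\rho},1/n)$-LSH family. For $q\in Q\setminus H$ and each $\ell$, inspect at most $10$ hubs $h$ with $f_\ell(h)=f_\ell(q)$, and let $\mathrm{close}_{ij\ell}(q)$ be one of them with $d(q,h)\le c_\rho2^j$ (null if there is none). Let $\mathrm{close}_{ij}(q)$ be some non-null $\mathrm{close}_{ij\ell}(q)$, $\mathrm{close}_i(q)$ the non-null $\mathrm{close}_{ij}(q)$ with smallest $j$, and $\mathrm{close}(q)$ some non-null $\mathrm{close}_i(q)$. FAIL if for some $q\in Q\setminus H$ all $\mathrm{close}_i(q)$ are null. * *Greedy$(R,h,r)$*. Start with $G=\{h\}$; while some $x\in R$ has $d(x,G)>4c_\rho r$, add to $G$ a point of $R$ furthest from $G$. Return $G$. * *Sample-And-Solve$(Q,p,r)$*.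 If $|Q|\le S$, return Greedy$(Q,q,r)$ for some $q\in Q$. Otherwise let the set of hubs $H$ contain each point of $Q$ independently with probability $p$; FAIL if $H=\emptyset$. Run Nearest-Hub-Search$(Q,H)$; for $h\in H$ let $B_h=\{h\}\cup\{q\in Q\setminus H:\mathrm{close}(q)=h\}$. If $|B_h|\le S$, put $S_h=$ Greedy$(B_h,h,r)$; otherwise split $B_h\setminus\{h\}$ into parts of at most $S-1$ points, add $h$ to each part, and let $S_h$ be the union of the outputs of Greedy on the parts, started at $h$. Return $\bigcup_{h\in H}S_h$. * *Uniform-Center$(V,r,t)$*. Put $S_0=V$, $p_0=\Theta(\log n/n^\delta)$, $s_0=t$, $s_i=\sqrt{s_{i-1}}$, and $p_i=1/s_i$ for $i\ge1$. For $i=1,\dots,\Theta(\log\log t)$ let $S_i=$ Sample-And-Solve$(S_{i-1},p_{i-1},r)$. Return the last $S_i$. * *Ext-$k$-Center*. Put $T_0=P$, $t_0=n$, $t_j=\Theta(\log t_{j-1}\cdot(\log\log t_{j-1})^{d+2})$ and $r_j=r/\log\log t_j$. Phase 1: for $j=1,\dots,\alpha$ let $T_j=$ Uniform-Center$(T_{j-1},r_{j-1},t_{j-1})$.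 Phase 2: for $i=1,\dots,\beta=\Theta(\log^{(\alpha+1)}n)$ let $T_{\alpha+i}=$ Sample-And-Solve$(T_{\alpha+i-1},\tfrac12,r)$. Output $T=T_{\alpha+\beta}$. If a subroutine reports FAIL, so does the algorithm. **Theorem.** For every $\rho\in(0,1)$ there is a constant $c_\rho>1$ such that for every $d$ there are $(s,c_\rho s,n^{-\rho},1/n)$-LSH families on $\mathbb R^d$ (one for each $n\ge2$ and each $s>0$, fixed in advance) with the following property. For all $\delta\in(0,1)$ and $\sigma>0$ there are constant factors for the $\Theta$'s of the algorithm and a constant $b$ such that, for every $\omega>0$, there are $\kappa>0$, $c_0\in\mathbb N$ and functions $g(x)=\widetilde\Theta(x)$ and $h(x)=\widetilde\Theta(x^3)$ for which the following holds. Let $P\subset\mathbb R^d$ be a set of $n$ points with pairwise distances at least $1$, let $1\le\alpha\le\log^*n-c_0$ and $r>0$, and let $\mathcal C_r$ be a clustering of $P$ with the minimum number of clusters among all clusterings of $P$ of cost at most $r$, where $|\mathcal C_r|\ge\omega(\log n)^b$. Then, with probability at least $$1-\frac{1}{(\log^{(\alpha-1)}n)^{\kappa}},$$ Ext-$k$-Center$(P,r)$,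 using these hash families, does not report FAIL and outputs a set $T$ with $$|T|\le|\mathcal C_r|\Bigl(1+\frac1{g(\log^{(\alpha)}n)}\Bigr)+h(\log^{(\alpha)}n).$$ None of the constants and functions depends on $P$, $n$, $\alpha$ or $r$. -/

import Mathlib

/-! Randomized `k`-center clustering by locality sensitive sampling. -/

noncomputable section

open scoped Classical

namespace KCenter

/-- The iterated (natural) logarithm `log^{(k)} x`. -/
def iterLog (k : ℕ) (x : ℝ) : ℝ := Real.log^[k] x

/-- `log* x`: how often `log` has to be applied to `x` to reach a value `≤ 1`. -/
def logStar (x : ℝ) : ℕ := sInf {k : ℕ | iterLog k x ≤ 1}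

/-- `g = Θ̃(f)` as the argument tends to infinity: equality up to constant factors and
polynomial factors in `log f`. -/
def IsThetaTilde (g f : ℝ → ℝ) : Prop :=
  ∃ (a : ℕ) (c C : ℝ), 0 < c ∧ 0 < C ∧ ∀ᶠ x in Filter.atTop,
    c * (f x / Real.log (f x) ^ a) ≤ g x ∧ g x ≤ C * (f x * Real.log (f x) ^ a)

/-- Points of Euclidean `d`-space. -/
abbrev Pt (d : ℕ) : Type := EuclideanSpace ℝ (Fin d)

/-! ### Clusterings -/

/-- A clustering of `P` is a partition of `P` into nonempty clusters. -/
abbrev Clustering {d : ℕ} (P : Finset (Pt d)) : Type := Finpartition P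

/-- The radius `min_{x ∈ C} max_{y ∈ C} d(x, y)` of a (nonempty, finite) cluster. -/
def radius {d : ℕ} (C : Finset (Pt d)) : ℝ := ⨅ x : C, ⨆ y : C, dist x.1 y.1

/-- The cost of a clustering is the maximum of the radii of its clusters. -/
def Clustering.cost {d : ℕ} {P : Finset (Pt d)} (𝒞 : Clustering P) : ℝ :=
  ⨆ C : 𝒞.parts, radius C.1

/-- `𝒞` has the minimum number of clusters among all clusterings of `P` of cost at most `r`. -/
def IsMinClustering {d : ℕ} {P : Finset (Pt d)} (r : ℝ) (𝒞 : Clustering P) : Prop :=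
  𝒞.cost ≤ r ∧ ∀ 𝒟 : Clustering P, 𝒟.cost ≤ r → 𝒞.parts.card ≤ 𝒟.parts.card

/-! ### Discrete probability -/

/-- The probability of an event under a discrete distribution. -/
def prob {A : Type*} (p : PMF A) (s : Set A) : ℝ := (p.toOuterMeasure s).toReal

/-- Independent samples from `p 0, …, p (k-1)`. -/
def indep {A : Type*} : (k : ℕ) → (Fin k → PMF A) → PMF (Fin k → A)
  | 0, _ => PMF.pure Fin.elim0
  | k + 1, p => (p 0).bind fun a =>
      (indep k fun i => p i.succ).bind fun f => PMF.pure (Fin.cons a f)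

/-- The random subset of `Q` that contains each point of `Q` independently with probability `p`
(with probability `1` if `p > 1`). -/
def sampleSubset {d : ℕ} (Q : Finset (Pt d)) (p : ℝ) : PMF (Finset (Pt d)) :=
  PMF.ofFinset
    (fun H => if H ⊆ Q then ENNReal.ofReal (min p 1) ^ H.card *
      (1 - ENNReal.ofReal (min p 1)) ^ (Q.card - H.card) else 0)
    Q.powerset
    (by
      have hp : ENNReal.ofReal (min p 1) ≤ 1 := by
        simp
      rw [Finset.sum_congr rfl (fun H hH => if_pos (Finset.mem_powerset.1 hH)),
        Finset.sum_pow_mul_eq_add_pow, add_tsub_cancel_of_le hp, one_pow])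
    (by
      intro H hH
      rw [if_neg]
      simpa using hH)

/-- Sequential composition of randomized procedures; `none` stands for the report FAIL. -/
def andThen {A B : Type*} (p : PMF (Option A)) (f : A → PMF (Option B)) : PMF (Option B) :=
  p.bind fun o => match o with
    | none => PMF.pure none
    | some a => f a

/-- A distribution on hash functions of `ℝ^d` (with values in `ℕ`) is an `(r, R, p₁, p₂)`-LSH
family. -/
structure IsLSH {d : ℕ} (ℋ : PMF (Pt d → ℕ)) (r R p₁ p₂ : ℝ) : Prop where
  near : ∀ x y : Pt d, dist x y ≤ r → p₁ ≤ prob ℋ {f | f x = f y}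
  far : ∀ x y : Pt d, R ≤ dist x y → prob ℋ {f | f x = f y} ≤ p₂

/-! ### The algorithm -/

/-- The data that all subroutines share. -/
structure Env (d : ℕ) where
  /-- number of input points -/
  n : ℕ
  /-- maximum distance between two input points -/
  Δ : ℝ
  /-- local space of a machine -/
  S : ℕ
  /-- approximation factor of the hash families -/
  c : ℝ
  /-- number of repetitions in the nearest hub search -/
  reps : ℕ
  /-- number of hash functions per repetition and scale -/
  hashes : ℕ
  /-- sampling probability in the first round of the uniform center algorithm -/
  p₀ : ℝ
  /-- hash family at a given scale -/
  hash : ℝ → PMF (Pt d → ℕ)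
  /-- a listing of each finite set, by which all arbitrary choices are made -/
  lst : Finset (Pt d) → List (Pt d)

/-- `lst` lists the elements of each finite set, in an arbitrary order. -/
def IsListing {d : ℕ} (lst : Finset (Pt d) → List (Pt d)) : Prop :=
  ∀ A : Finset (Pt d), (lst A).Nodup ∧ ∀ x, x ∈ lst A ↔ x ∈ A

section
variable {d : ℕ} (e : Env d)

/-- An arbitrary element of `A` (`none` if `A` is empty). -/
def Env.choose (A : Finset (Pt d)) : Option (Pt d) := (e.lst A).head?

/-- The scales of the nearest hub search are `2^0, …, 2^numScales`. -/
def Env.numScales : ℕ := ⌈Real.logb 2 e.Δ⌉₊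

/-- `close_{ijℓ}(q)`: inspect at most 10 hubs with the same hash value as `q`, and return one
at distance at most `c * s`, where `s` is the scale. -/
def closeHash (H : Finset (Pt d)) (s : ℝ) (f : Pt d → ℕ) (q : Pt d) : Option (Pt d) :=
  ((e.lst (H.filter fun h => f h = f q)).take 10).find? fun h => decide (dist q h ≤ e.c * s)

/-- `close_{ij}(q)`: some `close_{ijℓ}(q)` that is not null. -/
def closeScale (H : Finset (Pt d)) (s : ℝ) (f : Fin e.hashes → Pt d → ℕ) (q : Pt d) :
    Option (Pt d) :=
  e.choose (H.filter fun h => ∃ l, closeHash e H s (f l) q = some h)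

/-- `close_i(q)`: the `close_{ij}(q)` that is not null and has the smallest `j`. -/
def closeRep (H : Finset (Pt d)) (f : Fin (e.numScales + 1) → Fin e.hashes → Pt d → ℕ)
    (q : Pt d) : Option (Pt d) :=
  (List.finRange (e.numScales + 1)).findSome? fun j : Fin (e.numScales + 1) =>
    closeScale e H (2 ^ (j : ℕ)) (f j) q

/-- `close(q)`: some `close_i(q)` that is not null. -/
def closeHub (H : Finset (Pt d))
    (f : Fin e.reps → Fin (e.numScales + 1) → Fin e.hashes → Pt d → ℕ) (q : Pt d) :
    Option (Pt d) :=
  e.choose (H.filter fun h => ∃ i, closeRep e H (f i) q = some h)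

/-- Nearest-Hub-Search: find a nearby hub in `H` for each point of `Q \ H`, or FAIL. -/
def nearestHubSearch (Q H : Finset (Pt d)) : PMF (Option (Pt d → Pt d)) :=
  (indep e.reps fun _ => indep (e.numScales + 1) fun j =>
      indep e.hashes fun _ => e.hash (2 ^ (j : ℕ))).map fun f =>
    if ∀ q ∈ Q \ H, (closeHub e H f q).isSome then
      some fun q => (closeHub e H f q).getD q
    else none

/-- One step of the greedy algorithm: add a point of `R` furthest from `G`, if its distance
from `G` exceeds `4 c r`; otherwise do nothing. -/
def greedyStep (R : Finset (Pt d)) (r : ℝ) (G : Finset (Pt d)) : Finset (Pt d) :=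
  match e.choose (R.filter fun x => 4 * e.c * r < Metric.infDist x (G : Set (Pt d)) ∧
      ∀ y ∈ R, Metric.infDist y (G : Set (Pt d)) ≤ Metric.infDist x (G : Set (Pt d))) with
  | some x => insert x G
  | none => G

/-- Greedy, started at `h ∈ R`. Every effective step adds a new point of `R`, so that nothing
changes any more after `R.card` steps. -/
def greedy (R : Finset (Pt d)) (h : Pt d) (r : ℝ) : Finset (Pt d) :=
  (greedyStep e R r)^[R.card] {h}

/-- The centers chosen from the bag `B` of the hub `h ∈ B`. If `B` exceeds the local space `S`,
the points of `B` other than `h` are divided into consecutive blocks of `S - 1` points, and `h`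
is added to each block. (Blocks beyond the end of the list are empty; they only contribute `h`.) -/
def bagCenters (B : Finset (Pt d)) (h : Pt d) (r : ℝ) : Finset (Pt d) :=
  if B.card ≤ e.S then greedy e B h r
  else (Finset.range B.card).biUnion fun k =>
    greedy e (insert h (((e.lst (B.erase h)).drop (k * (e.S - 1))).take (e.S - 1)).toFinset) h r

/-- Sample-And-Solve `(Q, p, r)`. -/
def sampleAndSolve (Q : Finset (Pt d)) (p r : ℝ) : PMF (Option (Finset (Pt d))) :=
  if Q.card ≤ e.S then
    PMF.pure (some (match e.choose Q with
      | some q => greedy e Q q r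
      | none => ∅))
  else (sampleSubset Q p).bind fun H =>
    if H = ∅ then PMF.pure none
    else (nearestHubSearch e Q H).map fun o => o.map fun close =>
      H.biUnion fun h => bagCenters e (insert h ((Q \ H).filter fun q => close q = h)) h r

/-- `s_0 = t`, `s_{i+1} = √s_i`. -/
def sSeq (t : ℝ) : ℕ → ℝ
  | 0 => t
  | i + 1 => Real.sqrt (sSeq t i)

/-- The sampling probabilities of the uniform center algorithm: `p_0`, and `p_i = 1 / s_i` for
`i ≥ 1`. -/
def pSeq (t : ℝ) : ℕ → ℝ
  | 0 => e.p₀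
  | i + 1 => 1 / sSeq t (i + 1)

/-- `uniformCenter e V r t τ` is Uniform-Center `(V, r, t)` with `τ` iterations. -/
def uniformCenter (V : Finset (Pt d)) (r t : ℝ) : ℕ → PMF (Option (Finset (Pt d)))
  | 0 => PMF.pure (some V)
  | i + 1 => andThen (uniformCenter V r t i) fun Q => sampleAndSolve e Q (pSeq e t i) r

end

/-- The constant factors of the algorithm's parameters. -/
structure Consts where
  kP : ℝ
  kτ : ℝ
  kT : ℝ
  kβ : ℝ
  kI : ℝ
  kL : ℝ
  kP_pos : 0 < kP
  kτ_pos : 0 < kτ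
  kT_pos : 0 < kT
  kβ_pos : 0 < kβ
  kI_pos : 0 < kI
  kL_pos : 0 < kL

section
variable {d : ℕ}

/-- `t_0 = n`, `t_{j+1} = kT * log t_j * (log log t_j)^(d+2)`. -/
def tSeq (d : ℕ) (kT : ℝ) (n : ℕ) : ℕ → ℝ
  | 0 => n
  | j + 1 => kT * Real.log (tSeq d kT n j) * Real.log (Real.log (tSeq d kT n j)) ^ (d + 2)

/-- Phase 1: the intermediate centers `T_j`. In subphase `j + 1` the uniform center algorithm is
called on `T_j` with `t = t_j`, radius parameter `r_j = r / log log t_j` and `Θ(log log t_j)`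
iterations. -/
def phase1 (e : Env d) (K : Consts) (P : Finset (Pt d)) (r : ℝ) :
    ℕ → PMF (Option (Finset (Pt d)))
  | 0 => PMF.pure (some P)
  | j + 1 => andThen (phase1 e K P r j) fun T =>
      uniformCenter e T (r / Real.log (Real.log (tSeq d K.kT e.n j))) (tSeq d K.kT e.n j)
        ⌈K.kτ * Real.log (Real.log (tSeq d K.kT e.n j))⌉₊

/-- Phase 2: the intermediate centers `T_{α+i}`. -/
def phase2 (e : Env d) (K : Consts) (P : Finset (Pt d)) (r : ℝ) (α : ℕ) :
    ℕ → PMF (Option (Finset (Pt d)))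
  | 0 => phase1 e K P r α
  | i + 1 => andThen (phase2 e K P r α i) fun T => sampleAndSolve e T (1 / 2) r

/-- The shared data for the input `P` with `n` points: local space `⌈σ n^δ⌉`, `Θ(log n)`
repetitions and `Θ(n^ρ)` hash functions in the nearest hub search, `p_0 = Θ(log n / n^δ)`. -/
def mkEnv (K : Consts) (ρ δ σ c : ℝ) (ℋ : ℕ → ℝ → PMF (Pt d → ℕ))
    (lst : Finset (Pt d) → List (Pt d)) (P : Finset (Pt d)) : Env d where
  n := P.card
  Δ := Metric.diam (P : Set (Pt d))
  S := ⌈σ * (P.card : ℝ) ^ δ⌉₊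
  c := c
  reps := ⌈K.kI * Real.log P.card⌉₊
  hashes := ⌈K.kL * (P.card : ℝ) ^ ρ⌉₊
  p₀ := K.kP * Real.log P.card / (P.card : ℝ) ^ δ
  hash := ℋ P.card
  lst := lst

/-- The distribution of the output of Ext-`k`-Center `(P, r)` with tradeoff parameter `α`;
`none` is the report FAIL. -/
def extKCenter (K : Consts) (ρ δ σ c : ℝ) (ℋ : ℕ → ℝ → PMF (Pt d → ℕ))
    (lst : Finset (Pt d) → List (Pt d)) (α : ℕ) (P : Finset (Pt d)) (r : ℝ) :
    PMF (Option (Finset (Pt d))) :=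
  phase2 (mkEnv K ρ δ σ c ℋ lst P) K P r α ⌈K.kβ * iterLog (α + 1) P.card⌉₊

end

end KCenter

end

noncomputable section

open scoped Classical ENNReal

namespace KCenter

/-! ### Discrete probability -/

/-! The proof rests on one deterministic fact about Sample-And-Solve. Divide the points into classes
of diameter at most `2 * r`, and let every non-hub be assigned to a hub within the factor `2 * c` of
optimal. If a class contains a hub, each of its other points `x` lies within `4 * c * r` of its own
assigned hub, so Greedy, started at that hub, discards `x`. Hence a class of `m` points with `j`
sampled points keeps at most `j` of them, or at most `m` if `j = 0`; this is `survivors`, and the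
reduction is `sampleAndSolve_fails_le`.

The classes are sampled independently, so exponential moments multiply over them
(`sampleMean_prod`). With sampling probability `p` and at most `N` classes, the survivors number at
most `2 * p * |Q| + (N + u) / p` outside probability `exp (-u)` (`sum_survivors_upper`). With `p = 1
/ 2`, the excess over one point per class contracts by `2 / 3` up to an additive `2 * u`
(`sum_excess_upper`). A lower tail bound provides enough hubs whenever the local space does not
already suffice.

In Phase 1 the clusters are refined by a grid to diameter `2 * r / X`, `X = log log t`, at the cost
of a factor `O(X ^ d)` in their number. With `p = 1 / s` and `s` replaced by its square root in each
round, about `log log t` rounds reduce a bound `t` on points per cluster to `O(log t * X ^ d)` when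
the additive `u` is also charged to the clusters, which is below the next `t` (`subphase_fails_le`).
The `t` decrease so fast that the last subphase dominates the failure probability. In Phase 2 the
classes are the clusters themselves: with `L` the `α`-th iterated logarithm of the number of points,
`9 * log L` rounds shrink an excess of at most `L ^ 2` per cluster to `1 / L` per cluster plus `6 *
L` (`phase2_fails_le`).

Good assignments come from a dimension-free hash family: blocks of length `M`, randomly shifted, on
a random signed sum of coordinates, amplified by independent repetition (`exists_isLSH`). Its
parameters are stronger than demanded, which leaves room for a union bound over all far hubs
(`mkEnv_search`). -/

theorem outer_univ {A : Type*} (p : PMF A) : p.toOuterMeasure Set.univ = 1 := by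
  rw [PMF.toOuterMeasure_apply, Set.indicator_univ]
  exact p.tsum_coe

theorem outer_le_one {A : Type*} (p : PMF A) (s : Set A) : p.toOuterMeasure s ≤ 1 :=
  (MeasureTheory.measure_mono (Set.subset_univ _)).trans (outer_univ p).le

theorem outer_ne_top {A : Type*} (p : PMF A) (s : Set A) : p.toOuterMeasure s ≠ ⊤ :=
  ne_top_of_le_ne_top ENNReal.one_ne_top (outer_le_one p s)

/-- Union bound over two stages: either the first outcome is bad, or it is good and the second stage
fails conditionally on it. -/
theorem outer_bind_le {A B : Type*} (p : PMF A) (f : A → PMF B) (S : Set A) (s : Set B)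
    {ε δ : ℝ≥0∞} (hS : p.toOuterMeasure S ≤ ε)
    (hf : ∀ a ∈ p.support, a ∉ S → (f a).toOuterMeasure s ≤ δ) :
    (p.bind f).toOuterMeasure s ≤ ε + δ := by
  rw [PMF.toOuterMeasure_bind_apply]
  have h1 : ∀ a, p a * (f a).toOuterMeasure s ≤ S.indicator p a + p a * δ := by
    intro a
    by_cases haS : a ∈ S
    · rw [Set.indicator_of_mem haS]
      refine le_add_right ?_
      calc p a * (f a).toOuterMeasure s ≤ p a * 1 := by
            gcongr
            exact outer_le_one _ _
        _ = p a := mul_one _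
    · rw [Set.indicator_of_notMem haS, zero_add]
      by_cases hp : a ∈ p.support
      · gcongr
        exact hf a hp haS
      · rw [(p.apply_eq_zero_iff a).2 hp]
        simp
  refine (ENNReal.tsum_le_tsum h1).trans ?_
  rw [ENNReal.tsum_add, ENNReal.tsum_mul_right, p.tsum_coe, one_mul]
  gcongr
  rw [← PMF.toOuterMeasure_apply]
  exact hS

/-- The probability that a randomized procedure reports FAIL or violates `Φ`. -/
def fails {A : Type*} (p : PMF (Option A)) (Φ : A → Prop) : ℝ≥0∞ :=
  p.toOuterMeasure {o | ∀ a, o = some a → ¬ Φ a}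

theorem fails_mono {A : Type*} {p : PMF (Option A)} {Φ Ψ : A → Prop} (h : ∀ a, Φ a → Ψ a) :
    fails p Ψ ≤ fails p Φ :=
  MeasureTheory.measure_mono fun _ ho a ha hΦ => ho a ha (h a hΦ)

theorem outer_pure_le {A : Type*} {a : A} {s : Set A} (h : a ∉ s) {ε : ℝ≥0∞} :
    (PMF.pure a).toOuterMeasure s ≤ ε := by
  rw [PMF.toOuterMeasure_pure_apply, if_neg h]
  exact zero_le

theorem fails_pure_some {A : Type*} {a : A} {Φ : A → Prop} (h : Φ a) {ε : ℝ≥0∞} :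
    fails (PMF.pure (some a)) Φ ≤ ε :=
  outer_pure_le (s := {o | ∀ a, o = some a → ¬ Φ a}) fun h' => h' a rfl h

theorem fails_andThen {A B : Type*} {p : PMF (Option A)} {f : A → PMF (Option B)}
    {Φ : A → Prop} {Ψ : B → Prop} {ε δ : ℝ≥0∞} (hp : fails p Φ ≤ ε)
    (hf : ∀ a, Φ a → fails (f a) Ψ ≤ δ) : fails (andThen p f) Ψ ≤ ε + δ := by
  refine outer_bind_le p _ _ _ hp ?_
  rintro (_ | a) - ho
  · exact absurd (fun a h => by simp at h) ho
  · refine hf a ?_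
    by_contra hΦ
    exact ho fun b hb => by
      cases hb
      exact hΦ

theorem outer_add_compl {A : Type*} (p : PMF A) (s : Set A) :
    p.toOuterMeasure s + p.toOuterMeasure sᶜ = 1 := by
  simp only [PMF.toOuterMeasure_apply]
  rw [← ENNReal.tsum_add, ← p.tsum_coe]
  exact tsum_congr fun a => Set.indicator_self_add_compl_apply s p a

theorem prob_univ_sub {A : Type*} (p : PMF A) (s : Set A) {ε : ℝ} (hε : 0 ≤ ε)
    (h : p.toOuterMeasure sᶜ ≤ ENNReal.ofReal ε) : 1 - ε ≤ prob p s := by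
  have h1 := (outer_add_compl p s).ge
  have h2 := outer_ne_top p s
  have h3 : (1 : ℝ≥0∞) ≤ p.toOuterMeasure s + ENNReal.ofReal ε := h1.trans (by gcongr)
  have h4 := ENNReal.toReal_mono (by simp [h2]) h3
  rw [ENNReal.toReal_add h2 ENNReal.ofReal_ne_top, ENNReal.toReal_ofReal hε,
    ENNReal.toReal_one] at h4
  unfold prob
  linarith

theorem prob_compl {A : Type*} (p : PMF A) (s : Set A) : prob p sᶜ = 1 - prob p s := by
  have h := congrArg ENNReal.toReal (outer_add_compl p s)
  rw [ENNReal.toReal_add (outer_ne_top _ _) (outer_ne_top _ _), ENNReal.toReal_one] at h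
  unfold prob
  linarith

theorem prob_mono {A : Type*} (p : PMF A) {s t : Set A} (h : s ⊆ t) : prob p s ≤ prob p t :=
  ENNReal.toReal_mono (outer_ne_top _ _) (MeasureTheory.measure_mono h)

theorem prob_nonneg {A : Type*} (p : PMF A) (s : Set A) : 0 ≤ prob p s := ENNReal.toReal_nonneg

theorem ofReal_prob {A : Type*} (p : PMF A) (s : Set A) :
    ENNReal.ofReal (prob p s) = p.toOuterMeasure s := ENNReal.ofReal_toReal (outer_ne_top _ _)

theorem prob_union_le {A : Type*} (p : PMF A) (s t : Set A) :
    prob p (s ∪ t) ≤ prob p s + prob p t := by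
  unfold prob
  rw [← ENNReal.toReal_add (outer_ne_top _ _) (outer_ne_top _ _)]
  exact ENNReal.toReal_mono (by simp [outer_ne_top])
    (MeasureTheory.measure_union_le _ _)

theorem prob_biUnion_le {A I : Type*} (p : PMF A) (t : Finset I) (s : I → Set A) :
    prob p (⋃ i ∈ t, s i) ≤ ∑ i ∈ t, prob p (s i) := by
  unfold prob
  rw [← ENNReal.toReal_sum fun i _ => outer_ne_top _ _]
  exact ENNReal.toReal_mono (ENNReal.sum_ne_top.2 fun i _ => outer_ne_top _ _)
    (MeasureTheory.measure_biUnion_finset_le t s)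

theorem prob_map {A B : Type*} (p : PMF A) (f : A → B) (s : Set B) :
    prob (p.map f) s = prob p (f ⁻¹' s) := by
  unfold prob
  rw [PMF.toOuterMeasure_map_apply]

/-- Independence: the probability of a box is the product of the probabilities. -/
theorem prob_indep_pi {A : Type*} : ∀ (k : ℕ) (p : Fin k → PMF A) (s : Fin k → Set A),
    prob (indep k p) {f | ∀ i, f i ∈ s i} = ∏ i, prob (p i) (s i)
  | 0, p, s => by
      have h : {f : Fin 0 → A | ∀ i, f i ∈ s i} = Set.univ := by
        ext f
        simp
      rw [h]
      unfold prob
      rw [outer_univ]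
      simp
  | k + 1, p, s => by
      have ih := prob_indep_pi k (fun i => p i.succ) (fun i => s i.succ)
      have key : (indep (k + 1) p).toOuterMeasure {f | ∀ i, f i ∈ s i} =
          (p 0).toOuterMeasure (s 0) *
            (indep k fun i => p i.succ).toOuterMeasure {f | ∀ i, f i ∈ s i.succ} := by
        rw [indep, PMF.toOuterMeasure_bind_apply]
        have h1 : ∀ a, (p 0) a * (((indep k fun i => p i.succ).bind fun f =>
            PMF.pure (Fin.cons a f : Fin (k + 1) → A))).toOuterMeasure {f | ∀ i, f i ∈ s i} =
            (s 0).indicator (p 0) a *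
              (indep k fun i => p i.succ).toOuterMeasure {f | ∀ i, f i ∈ s i.succ} := by
          intro a
          have h2 : ((indep k fun i => p i.succ).bind fun f =>
              PMF.pure (Fin.cons a f : Fin (k + 1) → A)) =
              (indep k fun i => p i.succ).map fun f => Fin.cons a f := rfl
          rw [h2, PMF.toOuterMeasure_map_apply]
          by_cases ha : a ∈ s 0
          · rw [Set.indicator_of_mem ha]
            congr 2
            ext f
            simp [Fin.forall_fin_succ, ha]
          · rw [Set.indicator_of_notMem ha, zero_mul]
            have : (fun f : Fin k → A => (Fin.cons a f : Fin (k + 1) → A)) ⁻¹'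
                {f | ∀ i, f i ∈ s i} = ∅ := by
              ext f
              simp [Fin.forall_fin_succ, ha]
            rw [this]
            simp
        rw [tsum_congr h1, ENNReal.tsum_mul_right, ← PMF.toOuterMeasure_apply]
      unfold prob at ih ⊢
      rw [key, ENNReal.toReal_mul, ih, Fin.prod_univ_succ]

theorem prob_univ {A : Type*} (p : PMF A) : prob p Set.univ = 1 := by
  simp [prob, outer_univ]

theorem prob_indep_marginal {A : Type*} (k : ℕ) (p : Fin k → PMF A) (i : Fin k) (s : Set A) :
    prob (indep k p) {f | f i ∈ s} = prob (p i) s := by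
  have h := prob_indep_pi k p (fun j => if j = i then s else Set.univ)
  have h1 : {f : Fin k → A | ∀ j, f j ∈ (if j = i then s else Set.univ)} = {f | f i ∈ s} := by
    ext f
    constructor
    · intro h
      simpa using h i
    · intro h j
      by_cases hj : j = i
      · subst hj
        simpa using h
      · simp [hj]
  rw [h1] at h
  rw [h, Finset.prod_eq_single i]
  · simp
  · intro j _ hj
    simp [hj, prob_univ]
  · simp

/-! ### A locality sensitive hash family -/

/-- The sum `∑ ± z i` with the signs given by `a`. -/
def signSum {d : ℕ} (a : Fin d → Bool) (z : Fin d → ℝ) : ℝ :=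
  ∑ i, (if a i then 1 else -1) * z i

theorem sum_signs_succ {d : ℕ} (φ : ℝ → ℝ) (z : Fin (d + 1) → ℝ) :
    ∑ a : Fin (d + 1) → Bool, φ (signSum a z) =
      ∑ a : Fin d → Bool, (φ (z 0 + signSum a fun i => z i.succ) +
        φ (-z 0 + signSum a fun i => z i.succ)) := by
  rw [← (Fin.consEquiv fun _ => Bool).sum_comp, Fintype.sum_prod_type_right]
  refine Finset.sum_congr rfl fun a _ => ?_
  simp [signSum, Fin.sum_univ_succ, Fin.consEquiv]

theorem sum_signSum_sq : ∀ (d : ℕ) (z : Fin d → ℝ),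
    ∑ a : Fin d → Bool, signSum a z ^ 2 = 2 ^ d * ∑ i, z i ^ 2
  | 0, z => by simp [signSum]
  | d + 1, z => by
      rw [sum_signs_succ (fun x => x ^ 2), Fin.sum_univ_succ]
      have h : ∀ x y : ℝ, (x + y) ^ 2 + (-x + y) ^ 2 = 2 * x ^ 2 + 2 * y ^ 2 := by
        intros
        ring
      simp only [h, Finset.sum_add_distrib, ← Finset.mul_sum]
      rw [sum_signSum_sq d]
      simp
      ring

/-- Averaging over one sign removes the odd powers and leaves at most `x ^ 4 + 6 * x ^ 2 * v + 3 * v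
^ 2 ≤ 3 * (x ^ 2 + v) ^ 2`, where `v` is the sum of the remaining squares. -/
theorem sum_signSum_pow_four_le : ∀ (d : ℕ) (z : Fin d → ℝ),
    ∑ a : Fin d → Bool, signSum a z ^ 4 ≤ 3 * 2 ^ d * (∑ i, z i ^ 2) ^ 2
  | 0, z => by simp [signSum]
  | d + 1, z => by
      rw [sum_signs_succ (fun x => x ^ 4), Fin.sum_univ_succ]
      have h : ∀ x y : ℝ, (x + y) ^ 4 + (-x + y) ^ 4 =
          2 * x ^ 4 + 12 * x ^ 2 * y ^ 2 + 2 * y ^ 4 := by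
        intros
        ring
      simp only [h, Finset.sum_add_distrib, ← Finset.mul_sum]
      rw [sum_signSum_sq d]
      have ih := sum_signSum_pow_four_le d fun i => z i.succ
      set v := ∑ i : Fin d, z i.succ ^ 2
      have h2 : ∑ _a : Fin d → Bool, 2 * z 0 ^ 4 = 2 ^ d * (2 * z 0 ^ 4) := by
        simp
      simp only [← Finset.mul_sum, Finset.sum_const, Finset.card_univ, Fintype.card_pi,
        Fintype.card_bool, Finset.prod_const, Fintype.card_fin, nsmul_eq_mul] at h2 ⊢
      push_cast
      have h3 : 0 ≤ (2 : ℝ) ^ d * z 0 ^ 4 := by positivity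
      rw [pow_succ (2 : ℝ) d]
      nlinarith

/-- Anticoncentration of a random signed sum. -/
theorem card_signSum_large {d : ℕ} (z : Fin d → ℝ) (hz : 0 < ∑ i, z i ^ 2) :
    (3 / 16 : ℝ) * 2 ^ d ≤
      (Finset.univ.filter fun a : Fin d → Bool =>
        (∑ i, z i ^ 2) / 4 ≤ signSum a z ^ 2).card := by
  set v := ∑ i, z i ^ 2 with hv
  -- A quadratic minorant of the indicator, in `w = signSum a z ^ 2 / v`. Its mean is at least `(1 -
  -- 1/4) / 2 - 3 / 16 = 3 / 16` by the two moment formulas.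
  have h1 : ∀ a : Fin d → Bool, (signSum a z ^ 2 / v - 1 / 4) / 2 - signSum a z ^ 4 / v ^ 2 / 16 ≤
      if v / 4 ≤ signSum a z ^ 2 then 1 else 0 := by
    intro a
    have h4 : signSum a z ^ 4 / v ^ 2 = (signSum a z ^ 2 / v) ^ 2 := by
      rw [div_pow, ← pow_mul]
    rw [h4]
    split_ifs with h
    · nlinarith [sq_nonneg (signSum a z ^ 2 / v - 4)]
    · have : signSum a z ^ 2 / v ≤ 1 / 4 := by
        rw [div_le_iff₀ hz]
        linarith
      nlinarith [sq_nonneg (signSum a z ^ 2 / v)]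
  have h2 := Finset.sum_le_sum fun a (_ : a ∈ Finset.univ) => h1 a
  rw [Finset.sum_boole, Finset.sum_sub_distrib, ← Finset.sum_div, ← Finset.sum_div,
    ← Finset.sum_div, Finset.sum_sub_distrib, ← Finset.sum_div, sum_signSum_sq, ← hv] at h2
  have h3 := sum_signSum_pow_four_le d z
  rw [← hv] at h3
  have h4 : (∑ a : Fin d → Bool, signSum a z ^ 4) / v ^ 2 ≤ 3 * 2 ^ d := by
    rw [div_le_iff₀ (by positivity)]
    exact h3
  have h5 : 2 ^ d * v / v = 2 ^ d := by field_simp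
  rw [h5] at h2
  simp only [Finset.sum_const, Finset.card_univ, Fintype.card_pi,
        Fintype.card_bool, Finset.prod_const, Fintype.card_fin, nsmul_eq_mul] at h2
  push_cast at h2
  linarith

/-- Over a full period of shifts the quotients telescope, so each unit step of the numerator raises
their sum by exactly one. -/
theorem sum_shift_div (M : ℕ) (hM : 0 < M) (A : ℤ) (n : ℕ) :
    ∑ b ∈ Finset.range M, ((A + n + b) / (M : ℤ) - (A + b) / (M : ℤ)) = n := by
  induction n with
  | zero => simp
  | succ n ih =>
    have h : ∑ b ∈ Finset.range M, ((A + n + (b + 1 : ℕ)) / (M : ℤ) - (A + n + b) / (M : ℤ)) =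
        1 := by
      rw [Finset.sum_range_sub fun b : ℕ => (A + n + b) / (M : ℤ), Nat.cast_zero, add_zero,
        Int.add_ediv_of_dvd_right (dvd_refl _), Int.ediv_self (by omega)]
      ring
    calc _ = ∑ b ∈ Finset.range M, (((A + n + (b + 1 : ℕ)) / (M : ℤ) - (A + n + b) / (M : ℤ)) +
          ((A + n + b) / (M : ℤ) - (A + b) / (M : ℤ))) := by
          refine Finset.sum_congr rfl fun b _ => ?_
          push_cast
          rw [show A + (n + 1) + b = A + n + (b + 1 : ℤ) by ring]
          ring
      _ = _ := by
          rw [Finset.sum_add_distrib, h, ih]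
          push_cast
          ring

/-- A random shift separates two integers into different blocks of length `M` with probability
at most their distance divided by `M`. -/
theorem card_shift_ne_le (M : ℕ) (hM : 0 < M) (A B : ℤ) :
    ((Finset.univ.filter fun b : Fin M =>
      (A + (b : ℕ)) / (M : ℤ) ≠ (B + (b : ℕ)) / (M : ℤ)).card : ℤ) ≤ |A - B| := by
  wlog hAB : A ≤ B generalizing A B
  · rw [abs_sub_comm]
    simpa only [ne_comm] using this B A (by omega)
  obtain ⟨n, rfl⟩ := Int.le.dest hAB
  have h := sum_shift_div M hM A n
  rw [← Fin.sum_univ_eq_sum_range (fun b : ℕ => (A + n + b) / (M : ℤ) - (A + b) / (M : ℤ))] at h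
  have h1 : |A - (A + n)| = n := by
    rw [sub_add_cancel_left, abs_neg]
    simp
  rw [h1]
  refine le_of_le_of_eq ?_ h
  rw [Finset.card_filter]
  push_cast
  refine Finset.sum_le_sum fun b _ => ?_
  have hmono : (A + (b : ℕ)) / (M : ℤ) ≤ (A + n + (b : ℕ)) / (M : ℤ) :=
    Int.ediv_le_ediv (by omega) (by omega)
  split_ifs with hne <;> omega

/-- The elementary hash function with signs `a` and shift `b`, at scale `s`. -/
def baseHash {d M : ℕ} (s : ℝ) (ab : (Fin d → Bool) × Fin M) (x : Pt d) : ℤ :=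
  (⌊signSum ab.1 (fun i => x i) / s⌋ + (ab.2 : ℕ)) / (M : ℤ)

theorem signSum_sub {d : ℕ} (a : Fin d → Bool) (x y : Pt d) :
    signSum a (fun i => x i) - signSum a (fun i => y i) = signSum a fun i => x i - y i := by
  simp only [signSum, ← Finset.sum_sub_distrib, mul_sub]

theorem sum_sq_sub {d : ℕ} (x y : Pt d) : ∑ i, (x i - y i) ^ 2 = dist x y ^ 2 := by
  rw [EuclideanSpace.dist_eq, Real.sq_sqrt (by positivity)]
  simp [Real.dist_eq]

theorem card_prod_filter {α β : Type*} [Fintype α] [Fintype β] (p : α × β → Prop)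
    [DecidablePred p] :
    (Finset.univ.filter p).card =
      ∑ a : α, (Finset.univ.filter fun b : β => p (a, b)).card := by
  simp only [Finset.card_filter]
  rw [Fintype.sum_prod_type]

/-- The separating shifts number at most the distance of the two floors, which does not depend on
`M`, and the second moment of the projection bounds its average by `2`. Out of `2 ^ d * M` choices
this is probability `2 / M`. -/
theorem baseHash_near {d M : ℕ} (hM : 0 < M) {s : ℝ} (hs : 0 < s) (x y : Pt d)
    (h : dist x y ≤ s) :
    ((Finset.univ.filter fun ab : (Fin d → Bool) × Fin M =>
      baseHash s ab x ≠ baseHash s ab y).card : ℝ) ≤ 2 * 2 ^ d := by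
  rw [card_prod_filter]
  push_cast
  -- The inequality `|u| + 1 ≤ u ^ 2 / 2 + 3 / 2` brings in the second moment, which is known
  -- exactly.
  have h1 : ∀ a : Fin d → Bool, ((Finset.univ.filter fun b : Fin M =>
      baseHash s (a, b) x ≠ baseHash s (a, b) y).card : ℝ) ≤
        signSum a (fun i => x i - y i) ^ 2 / s ^ 2 / 2 + 3 / 2 := by
    intro a
    have h2 := card_shift_ne_le M hM ⌊signSum a (fun i => x i) / s⌋
      ⌊signSum a (fun i => y i) / s⌋
    have h3 : |((⌊signSum a (fun i => x i) / s⌋ : ℝ) - ⌊signSum a (fun i => y i) / s⌋)| ≤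
        |signSum a (fun i => x i - y i) / s| + 1 := by
      rw [← signSum_sub, sub_div]
      have f1 := Int.floor_le (signSum a (fun i => x i) / s)
      have f2 := Int.lt_floor_add_one (signSum a (fun i => x i) / s)
      have f3 := Int.floor_le (signSum a (fun i => y i) / s)
      have f4 := Int.lt_floor_add_one (signSum a (fun i => y i) / s)
      have f5 := le_abs_self (signSum a (fun i => x i) / s - signSum a (fun i => y i) / s)
      have f6 := neg_abs_le (signSum a (fun i => x i) / s - signSum a (fun i => y i) / s)
      rw [abs_le]
      constructor <;> linarith
    have h4 : ((Finset.univ.filter fun b : Fin M =>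
      baseHash s (a, b) x ≠ baseHash s (a, b) y).card : ℝ) ≤
        |((⌊signSum a (fun i => x i) / s⌋ : ℝ) - ⌊signSum a (fun i => y i) / s⌋)| := by
      exact_mod_cast h2
    have h5 : signSum a (fun i => x i - y i) ^ 2 / s ^ 2 =
        |signSum a (fun i => x i - y i) / s| ^ 2 := by
      rw [sq_abs, div_pow]
    rw [h5]
    nlinarith [sq_nonneg (|signSum a (fun i => x i - y i) / s| - 1)]
  refine (Finset.sum_le_sum fun a _ => h1 a).trans ?_
  rw [Finset.sum_add_distrib, ← Finset.sum_div, ← Finset.sum_div, sum_signSum_sq, sum_sq_sub]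
  have h2 : dist x y ^ 2 / s ^ 2 ≤ 1 := by
    rw [div_le_one (by positivity)]
    exact pow_le_pow_left₀ dist_nonneg h 2
  simp only [Finset.sum_const, Finset.card_univ, Fintype.card_pi,
        Fintype.card_bool, Finset.prod_const, Fintype.card_fin, nsmul_eq_mul]
  push_cast
  rw [mul_div_assoc]
  have : (0 : ℝ) < 2 ^ d := by positivity
  nlinarith

/-- By anticoncentration, at least `3 / 16` of the sign patterns keep half of the distance. The
projections then differ by `M + 1` in units of `s`, the floors by at least `M`, and no shift puts
them into one block. -/
theorem baseHash_far {d M : ℕ} (hM : 0 < M) {s : ℝ} (hs : 0 < s) (x y : Pt d)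
    (h : 2 * (M + 1 : ℝ) * s ≤ dist x y) :
    (3 / 16 : ℝ) * (2 ^ d * M) ≤ ((Finset.univ.filter fun ab : (Fin d → Bool) × Fin M =>
      baseHash s ab x ≠ baseHash s ab y).card : ℝ) := by
  have hv : (0 : ℝ) < ∑ i, (x i - y i) ^ 2 := by
    rw [sum_sq_sub]
    have : 0 < 2 * (M + 1 : ℝ) * s := by positivity
    have : 0 < dist x y := by linarith
    positivity
  have h1 := card_signSum_large (fun i => x i - y i) hv
  rw [card_prod_filter]
  rw [sum_sq_sub] at h1
  have h2 : ∀ a : Fin d → Bool, dist x y ^ 2 / 4 ≤ signSum a (fun i => x i - y i) ^ 2 →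
      ∀ b : Fin M, baseHash s (a, b) x ≠ baseHash s (a, b) y := by
    intro a ha b
    have h3 : (M + 1 : ℝ) * s ≤ |signSum a (fun i => x i - y i)| := by
      refine abs_le_of_sq_le_sq' ?_ (abs_nonneg _) |>.2
      rw [sq_abs]
      refine le_trans ?_ ha
      have := pow_le_pow_left₀ (by positivity) h 2
      nlinarith
    rw [← signSum_sub] at h3
    have h4 : (M + 1 : ℝ) ≤
        |signSum a (fun i => x i) / s - signSum a (fun i => y i) / s| := by
      rw [← sub_div, abs_div, abs_of_pos hs, le_div_iff₀ hs]
      exact h3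
    have f1 := Int.floor_le (signSum a (fun i => x i) / s)
    have f2 := Int.lt_floor_add_one (signSum a (fun i => x i) / s)
    have f3 := Int.floor_le (signSum a (fun i => y i) / s)
    have f4 := Int.lt_floor_add_one (signSum a (fun i => y i) / s)
    have key : ∀ A B : ℤ, A + M ≤ B → (A + (b : ℕ)) / (M : ℤ) ≠ (B + (b : ℕ)) / (M : ℤ) := by
      intro A B hAB
      have h5 : (A + M + (b : ℕ)) / (M : ℤ) ≤ (B + (b : ℕ)) / (M : ℤ) :=
        Int.ediv_le_ediv (by omega) (by omega)
      have h6 : (A + M + (b : ℕ)) / (M : ℤ) = (A + (b : ℕ)) / (M : ℤ) + 1 := by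
        rw [add_right_comm, Int.add_ediv_of_dvd_right (dvd_refl _), Int.ediv_self (by omega)]
      omega
    unfold baseHash
    rcases le_abs.1 h4 with h5 | h5
    · refine (key _ _ ?_).symm
      have : ((⌊signSum a (fun i => y i) / s⌋ + M : ℤ) : ℝ) <
        (⌊signSum a (fun i => x i) / s⌋ + 1 : ℤ) := by
        push_cast
        linarith
      have := Int.cast_lt.1 this
      simp only
      omega
    · refine key _ _ ?_
      have : ((⌊signSum a (fun i => x i) / s⌋ + M : ℤ) : ℝ) <
        (⌊signSum a (fun i => y i) / s⌋ + 1 : ℤ) := by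
        push_cast
        linarith
      have := Int.cast_lt.1 this
      simp only
      omega
  have h3 : ∑ a : Fin d → Bool, (if dist x y ^ 2 / 4 ≤ signSum a (fun i => x i - y i) ^ 2
      then M else 0) ≤ ∑ a : Fin d → Bool, (Finset.univ.filter fun b : Fin M =>
        baseHash s (a, b) x ≠ baseHash s (a, b) y).card := by
    refine Finset.sum_le_sum fun a _ => ?_
    split_ifs with ha
    · rw [Finset.filter_true_of_mem fun b _ => h2 a ha b]
      simp
    · exact Nat.zero_le _
  rw [← Finset.sum_filter, Finset.sum_const, smul_eq_mul] at h3
  calc (3 / 16 : ℝ) * (2 ^ d * M) = 3 / 16 * 2 ^ d * M := by ring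
    _ ≤ _ := mul_le_mul_of_nonneg_right h1 (by positivity)
    _ ≤ _ := by exact_mod_cast h3

/-- The distribution of the elementary hash function. -/
def baseFamily (d M : ℕ) [NeZero M] (s : ℝ) : PMF (Pt d → ℤ) :=
  (PMF.uniformOfFintype ((Fin d → Bool) × Fin M)).map (baseHash s)

theorem prob_baseFamily {d M : ℕ} [NeZero M] (s : ℝ) (x y : Pt d) :
    prob (baseFamily d M s) {f | f x = f y} = 1 - ((Finset.univ.filter
      fun ab : (Fin d → Bool) × Fin M => baseHash s ab x ≠ baseHash s ab y).card : ℝ) /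
        (2 ^ d * M) := by
  rw [← sub_sub_cancel 1 (prob (baseFamily d M s) {f | f x = f y}), ← prob_compl, baseFamily,
    prob_map, prob, PMF.toOuterMeasure_uniformOfFintype_apply, ENNReal.toReal_div]
  congr 2
  · simp only [ENNReal.toReal_natCast]
    rw [Fintype.card_subtype]
    refine congrArg _ (congrArg _ ?_)
    ext ab
    simp
  · simp

/-- The hash family: `k` independent elementary hash functions. -/
def hashFamily (d M : ℕ) [NeZero M] (k : ℕ) (s : ℝ) : PMF (Pt d → ℕ) :=
  (indep k fun _ => baseFamily d M s).map fun f x => Encodable.encode fun i => f i x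

theorem prob_hashFamily {d M : ℕ} [NeZero M] (k : ℕ) (s : ℝ) (x y : Pt d) :
    prob (hashFamily d M k s) {f | f x = f y} =
      prob (baseFamily d M s) {f | f x = f y} ^ k := by
  rw [hashFamily, prob_map]
  have h : (fun (f : Fin k → Pt d → ℤ) x => Encodable.encode fun i => f i x) ⁻¹'
      {f | f x = f y} = {f | ∀ i, f i ∈ {f : Pt d → ℤ | f x = f y}} := by
    ext f
    simp [Encodable.encode_inj, funext_iff]
  rw [h, prob_indep_pi]
  simp

/-- Hash families with approximation factor independent of the dimension. -/
theorem exists_isLSH {ρ : ℝ} (hρ : 0 < ρ) : ∃ c : ℝ, 1 < c ∧ ∀ d : ℕ,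
    ∃ ℋ : ℕ → ℝ → PMF (Pt d → ℕ), ∀ n : ℕ, 2 ≤ n → ∀ s : ℝ, 0 < s →
      IsLSH (ℋ n s) s (c * s) ((1 / (n : ℝ)) ^ (ρ / 2)) ((1 / (n : ℝ)) ^ 2) := by
  obtain ⟨M, hM⟩ := exists_nat_ge (104 / ρ + 4)
  have hρ' : 0 < 104 / ρ := by positivity
  have hM4 : (4 : ℝ) ≤ M := by linarith
  have hM0 : 0 < M := by
    have : (0 : ℝ) < M := by linarith
    exact_mod_cast this
  have : NeZero M := ⟨hM0.ne'⟩
  -- `M` depends on `ρ` only, so the factor is independent of `d`. With `k` about `11 * log n`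
  -- copies, far points collide with probability at most `exp (-3 * k / 16) ≤ n ^ (-2)`. Since `k ≤
  -- 13 * log n` and `4 / M ≤ ρ / 26`, near points collide with probability at least `n ^ (-ρ / 2)`.
  refine ⟨2 * (M + 1), by linarith, fun d =>
    ⟨fun n s => hashFamily d M ⌈11 * Real.log n⌉₊ s, fun n hn s hs => ?_⟩⟩
  have hn' : (2 : ℝ) ≤ n := by exact_mod_cast hn
  have hlog : 1 / 2 ≤ Real.log n := by
    have := Real.log_le_log (by norm_num) hn'
    linarith [Real.log_two_gt_d9]
  have hk1 := Nat.le_ceil (11 * Real.log n)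
  have hk2 := Nat.ceil_lt_add_one (a := 11 * Real.log n) (by linarith)
  set k := ⌈11 * Real.log n⌉₊
  have hdM : (0 : ℝ) < 2 ^ d * M := by positivity
  have hrp : ∀ a : ℝ, (1 / (n : ℝ)) ^ a = Real.exp (-(a * Real.log n)) := by
    intro a
    rw [one_div, Real.inv_rpow (by linarith), Real.rpow_def_of_pos (by linarith), ← Real.exp_neg]
    ring_nf
  constructor
  · intro x y hxy
    rw [prob_hashFamily, prob_baseFamily, hrp]
    have h1 := baseHash_near hM0 hs x y hxy
    have h2 : Real.exp (-(4 / M)) ≤ 1 - ((Finset.univ.filter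
      fun ab : (Fin d → Bool) × Fin M => baseHash s ab x ≠ baseHash s ab y).card : ℝ) /
        (2 ^ d * M) := by
      have h3 : ((Finset.univ.filter
        fun ab : (Fin d → Bool) × Fin M => baseHash s ab x ≠ baseHash s ab y).card : ℝ) /
        (2 ^ d * M) ≤ 2 / M := by
        rw [div_le_div_iff₀ hdM (by linarith)]
        nlinarith
      have h4 : Real.exp (-(4 / M)) ≤ 1 - 2 / M := by
        have hx : 4 / (M : ℝ) ≤ 1 := by
          rw [div_le_one (by linarith)]
          exact hM4
        have hx0 : 0 < 4 / (M : ℝ) := by positivity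
        rw [Real.exp_neg, inv_le_comm₀ (Real.exp_pos _)]
        · have h5 := Real.add_one_le_exp (4 / (M : ℝ))
          refine le_trans ?_ h5
          rw [inv_le_iff_one_le_mul₀]
          · have : 2 / (M : ℝ) = 4 / M / 2 := by ring
            rw [this]
            nlinarith
          · have : 2 / (M : ℝ) = 4 / M / 2 := by ring
            rw [this]
            linarith
        · have : 2 / (M : ℝ) = 4 / M / 2 := by ring
          rw [this]
          linarith
      linarith
    refine le_trans ?_ (pow_le_pow_left₀ (Real.exp_pos _).le h2 k)
    rw [← Real.exp_nat_mul, Real.exp_le_exp]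
    have h6 : 4 / (M : ℝ) ≤ ρ / 26 := by
      rw [div_le_div_iff₀ (by linarith) (by norm_num)]
      have h7 : 104 / ρ ≤ M := by linarith
      rw [div_le_iff₀ hρ] at h7
      linarith
    have h8 : (k : ℝ) ≤ 13 * Real.log n := by linarith
    have h9 : (k : ℝ) * (4 / M) ≤ 13 * Real.log n * (ρ / 26) :=
      mul_le_mul h8 h6 (by positivity) (by linarith)
    linarith
  · intro x y hxy
    rw [prob_hashFamily, prob_baseFamily, ← Real.rpow_natCast (1 / (n : ℝ)) 2, hrp]
    have h1 := baseHash_far hM0 hs x y hxy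
    have h2 : 1 - ((Finset.univ.filter
      fun ab : (Fin d → Bool) × Fin M => baseHash s ab x ≠ baseHash s ab y).card : ℝ) /
        (2 ^ d * M) ≤ Real.exp (-(3 / 16)) := by
      have h3 : 3 / 16 ≤ ((Finset.univ.filter
        fun ab : (Fin d → Bool) × Fin M => baseHash s ab x ≠ baseHash s ab y).card : ℝ) /
        (2 ^ d * M) := by
        rw [le_div_iff₀ hdM]
        exact h1
      linarith [Real.add_one_le_exp (-(3 / 16 : ℝ))]
    have h0 : 0 ≤ 1 - ((Finset.univ.filter
      fun ab : (Fin d → Bool) × Fin M => baseHash s ab x ≠ baseHash s ab y).card : ℝ) /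
        (2 ^ d * M) := by
      rw [← prob_baseFamily]
      exact prob_nonneg _ _
    refine (pow_le_pow_left₀ h0 h2 k).trans ?_
    rw [← Real.exp_nat_mul, Real.exp_le_exp]
    push_cast
    nlinarith

/-! ### Independent sampling -/

/-- The expectation of `F` over a random subset of `Q` that contains each element independently
with probability `p`. -/
def sampleMean {X : Type*} (Q : Finset X) (p : ℝ) (F : Finset X → ℝ) : ℝ :=
  ∑ H ∈ Q.powerset, p ^ H.card * (1 - p) ^ (Q.card - H.card) * F H

theorem sampleMean_pow {X : Type*} (Q : Finset X) (p z : ℝ) :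
    sampleMean Q p (fun H => z ^ H.card) = (p * z + (1 - p)) ^ Q.card := by
  rw [← Finset.sum_pow_mul_eq_add_pow]
  refine Finset.sum_congr rfl fun H _ => ?_
  rw [mul_pow]
  ring

/-- A subset of a disjoint union is a pair of subsets, and the Bernoulli weights multiply. -/
theorem sampleMean_union {X : Type*} {A B : Finset X} (hAB : Disjoint A B) (p : ℝ)
    (F G : Finset X → ℝ) :
    sampleMean (A ∪ B) p (fun H => F (H ∩ A) * G (H ∩ B)) =
      sampleMean A p F * sampleMean B p G := by
  unfold sampleMean
  rw [Finset.sum_mul_sum, ← Finset.sum_product']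
  have hdis := Finset.disjoint_left.1 hAB
  refine Finset.sum_bij' (fun H _ => (H ∩ A, H ∩ B)) (fun H _ => H.1 ∪ H.2) ?_ ?_ ?_ ?_ ?_
  · intro H _
    simp
  · intro H hH
    rw [Finset.mem_product, Finset.mem_powerset, Finset.mem_powerset] at hH
    exact Finset.mem_powerset.2 (Finset.union_subset_union hH.1 hH.2)
  · intro H hH
    rw [Finset.mem_powerset] at hH
    simp only
    rw [← Finset.inter_union_distrib_left, Finset.inter_eq_left.2 hH]
  · intro H hH
    rw [Finset.mem_product, Finset.mem_powerset, Finset.mem_powerset] at hH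
    ext x
    · simp only [Finset.mem_inter, Finset.mem_union]
      have h1 := @hH.1 x
      have h2 := @hH.2 x
      have h3 := @hdis x
      tauto
    · simp only [Finset.mem_inter, Finset.mem_union]
      have h1 := @hH.1 x
      have h2 := @hH.2 x
      have h3 := @hdis x
      tauto
  · intro H hH
    rw [Finset.mem_powerset] at hH
    have h1 : H.card = (H ∩ A).card + (H ∩ B).card := by
      rw [← Finset.card_union_of_disjoint, ← Finset.inter_union_distrib_left,
        Finset.inter_eq_left.2 hH]
      exact hAB.mono Finset.inter_subset_right Finset.inter_subset_right
    have h2 : (H ∩ A).card ≤ A.card := Finset.card_le_card Finset.inter_subset_right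
    have h3 : (H ∩ B).card ≤ B.card := Finset.card_le_card Finset.inter_subset_right
    have h4 : (A ∪ B).card - H.card = (A.card - (H ∩ A).card) + (B.card - (H ∩ B).card) := by
      rw [Finset.card_union_of_disjoint hAB]
      omega
    rw [h4, h1, pow_add, pow_add]
    ring

/-- The numbers of sampled elements in disjoint classes are independent. -/
theorem sampleMean_prod {X ι : Type*} (key : X → ι) (p : ℝ) (φ : ι → ℕ → ℝ) (I : Finset ι) :
    ∀ Q : Finset X, (∀ x ∈ Q, key x ∈ I) →
      sampleMean Q p (fun H => ∏ k ∈ I, φ k (H.filter fun x => key x = k).card) =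
        ∏ k ∈ I, sampleMean (Q.filter fun x => key x = k) p (fun H => φ k H.card) := by
  induction I using Finset.induction_on with
  | empty =>
    intro Q hQ
    have : Q = ∅ := Finset.eq_empty_of_forall_notMem fun x hx => by simpa using hQ x hx
    subst this
    simp [sampleMean]
  | insert k I hk ih =>
    intro Q hQ
    have hQ' : ∀ x ∈ Q.filter fun x => ¬ key x = k, key x ∈ I := by
      intro x hx
      rw [Finset.mem_filter] at hx
      exact (Finset.mem_insert.1 (hQ x hx.1)).resolve_left hx.2
    have h1 : ∀ j ∈ I, (Q.filter fun x => ¬ key x = k).filter (fun x => key x = j) =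
        Q.filter fun x => key x = j := by
      intro j hj
      ext x
      simp only [Finset.mem_filter]
      constructor
      · tauto
      · rintro ⟨h1, rfl⟩
        exact ⟨⟨h1, fun h => hk (h ▸ hj)⟩, rfl⟩
    have h2 := ih _ hQ'
    rw [Finset.prod_congr rfl fun j hj => by rw [h1 j hj]] at h2
    rw [Finset.prod_insert hk, ← h2,
      ← sampleMean_union (Finset.disjoint_filter_filter_not Q Q _),
      Finset.filter_union_filter_not_eq]
    refine Finset.sum_congr rfl fun H hH => ?_
    rw [Finset.mem_powerset] at hH
    simp only
    rw [Finset.prod_insert hk]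
    congr 2
    · congr 2
      ext x
      simp only [Finset.mem_filter, Finset.mem_inter]
      have := @hH x
      tauto
    · refine Finset.prod_congr rfl fun j hj => ?_
      congr 2
      ext x
      simp only [Finset.mem_filter, Finset.mem_inter]
      constructor
      · rintro ⟨h2, rfl⟩
        exact ⟨⟨h2, hH h2, fun h => hk (h ▸ hj)⟩, rfl⟩
      · tauto

/-- Markov's inequality. -/
theorem sampleSubset_markov {d : ℕ} (Q : Finset (Pt d)) {p : ℝ} (hp0 : 0 ≤ p) (hp1 : p ≤ 1)
    (F : Finset (Pt d) → ℝ) (hF : ∀ H, 0 ≤ F H) {A : ℝ} (hA : 0 < A) (bad : Set (Finset (Pt d)))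
    (hbad : ∀ H, H ⊆ Q → H ∈ bad → A ≤ F H) {ε : ℝ} (h : sampleMean Q p F ≤ ε * A) :
    (sampleSubset Q p).toOuterMeasure bad ≤ ENNReal.ofReal ε := by
  have hε : sampleMean Q p F / A ≤ ε := by
    rwa [div_le_iff₀ hA]
  refine le_trans ?_ (ENNReal.ofReal_le_ofReal hε)
  have hw : ∀ H, 0 ≤ p ^ H.card * (1 - p) ^ (Q.card - H.card) * F H := fun H =>
    mul_nonneg (mul_nonneg (pow_nonneg hp0 _) (pow_nonneg (by linarith) _)) (hF H)
  rw [PMF.toOuterMeasure_apply, tsum_eq_sum (s := Q.powerset), sampleMean, Finset.sum_div,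
    ENNReal.ofReal_sum_of_nonneg]
  · refine Finset.sum_le_sum fun H hH => ?_
    by_cases hHb : H ∈ bad
    · rw [Set.indicator_of_mem hHb, sampleSubset, PMF.ofFinset_apply,
        if_pos (Finset.mem_powerset.1 hH), min_eq_left hp1]
      have h1 : (1 : ℝ≥0∞) - ENNReal.ofReal p = ENNReal.ofReal (1 - p) := by
        rw [ENNReal.ofReal_sub _ hp0, ENNReal.ofReal_one]
      rw [h1, ← ENNReal.ofReal_pow hp0, ← ENNReal.ofReal_pow (by linarith),
        ← ENNReal.ofReal_mul (by positivity)]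
      refine ENNReal.ofReal_le_ofReal ?_
      rw [le_div_iff₀ hA]
      exact mul_le_mul_of_nonneg_left (hbad H (Finset.mem_powerset.1 hH) hHb)
        (mul_nonneg (pow_nonneg hp0 _) (pow_nonneg (by linarith) _))
    · rw [Set.indicator_of_notMem hHb]
      exact zero_le
  · intro H _
    exact div_nonneg (hw H) hA.le
  · intro H hH
    rw [Set.indicator_apply_eq_zero]
    intro _
    rw [sampleSubset, PMF.ofFinset_apply, if_neg]
    simpa using hH

theorem mem_support_sampleSubset {d : ℕ} {Q H : Finset (Pt d)} {p : ℝ}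
    (h : H ∈ (sampleSubset Q p).support) : H ⊆ Q := by
  by_contra hH
  refine h ?_
  rw [sampleSubset, PMF.ofFinset_apply, if_neg hH]

/-- A bound on the number of survivors of a class of `m` points, `j` of which are sampled. -/
def survivors (m j : ℕ) : ℕ := if j = 0 then m else j

/-- Survivors and sampled points differ in number only for the empty sample, whose weight is `(1 -
p) ^ A.card`. -/
theorem sampleMean_pow_survivors {X : Type*} (A : Finset X) (p z : ℝ) :
    sampleMean A p (fun H => z ^ survivors A.card H.card) =
      (p * z + (1 - p)) ^ A.card + (z ^ A.card - 1) * (1 - p) ^ A.card := by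
  rw [← sampleMean_pow]
  have h : ∀ H ∈ A.powerset, p ^ H.card * (1 - p) ^ (A.card - H.card) *
      z ^ survivors A.card H.card = p ^ H.card * (1 - p) ^ (A.card - H.card) * z ^ H.card +
        if H = ∅ then (z ^ A.card - 1) * (1 - p) ^ A.card else 0 := by
    intro H _
    by_cases hH : H = ∅
    · simp [hH, survivors]
      ring
    · simp [hH, survivors]
  unfold sampleMean
  rw [Finset.sum_congr rfl h, Finset.sum_add_distrib, Finset.sum_ite_eq' A.powerset ∅]
  simp

/-- The tilt `exp p` is matched to the sampling rate: an unsampled class contributes at most `(exp p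
* (1 - p)) ^ A.card ≤ 1`, however large it is. The sampled part contributes at most `(1 + 2 * p ^ 2)
^ A.card`. -/
theorem sampleMean_exp_survivors_le {X : Type*} (A : Finset X) {p : ℝ} (hp0 : 0 ≤ p)
    (hp1 : p ≤ 1) :
    sampleMean A p (fun H => Real.exp p ^ survivors A.card H.card) ≤
      2 * Real.exp (2 * p ^ 2 * A.card) := by
  rw [sampleMean_pow_survivors]
  have h1 : Real.exp p ≤ 1 + 2 * p := by
    have h2 := Real.abs_exp_sub_one_le (x := p) (by rw [abs_of_nonneg hp0]; exact hp1)
    rw [abs_of_nonneg hp0] at h2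
    linarith [le_abs_self (Real.exp p - 1)]
  have h2 : (p * Real.exp p + (1 - p)) ^ A.card ≤ Real.exp (2 * p ^ 2 * A.card) := by
    rw [mul_comm (2 * p ^ 2), Real.exp_nat_mul]
    refine pow_le_pow_left₀ ?_ ?_ _
    · have := Real.exp_pos p
      nlinarith
    · nlinarith [Real.add_one_le_exp (2 * p ^ 2)]
  have h3 : (Real.exp p * (1 - p)) ^ A.card ≤ 1 := by
    refine pow_le_one₀ ?_ ?_
    · exact mul_nonneg (Real.exp_pos p).le (by linarith)
    · have := Real.one_sub_le_exp_neg p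
      calc Real.exp p * (1 - p) ≤ Real.exp p * Real.exp (-p) := by gcongr
        _ = 1 := by rw [← Real.exp_add]; simp
  have h4 : 1 ≤ Real.exp (2 * p ^ 2 * A.card) := Real.one_le_exp (by positivity)
  have h5 : 0 ≤ (1 - p) ^ A.card := pow_nonneg (by linarith) _
  rw [mul_pow] at h3
  nlinarith

theorem two_pow_le_three_pow (m : ℕ) : (2 : ℝ) ^ (m + 1) - 1 ≤ 3 ^ m := by
  induction m with
  | zero => norm_num
  | succ m ih =>
    have : (1 : ℝ) ≤ 3 ^ m := one_le_pow₀ (by norm_num)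
    rw [pow_succ, pow_succ (3 : ℝ)]
    linarith

/-- With sampling probability `1 / 2` the excess of a class halves in expectation. -/
theorem sampleMean_two_pow_excess_le {X : Type*} (A : Finset X) :
    sampleMean A (1 / 2) (fun H => 2 ^ (survivors A.card H.card - 1)) ≤
      (3 / 2 : ℝ) ^ (A.card - 1) := by
  rcases Finset.eq_empty_or_nonempty A with rfl | hA
  · simp [sampleMean, survivors]
  obtain ⟨m, hm⟩ : ∃ m, A.card = m + 1 := ⟨A.card - 1, by have := hA.card_pos; omega⟩
  have h : sampleMean A (1 / 2) (fun H => (2 : ℝ) ^ (survivors A.card H.card - 1)) =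
      sampleMean A (1 / 2) (fun H => (2 : ℝ) ^ survivors A.card H.card) / 2 := by
    unfold sampleMean
    rw [Finset.sum_div]
    refine Finset.sum_congr rfl fun H _ => ?_
    have h1 : survivors A.card H.card - 1 + 1 = survivors A.card H.card := by
      unfold survivors
      split_ifs <;> omega
    have h2 : (2 : ℝ) ^ survivors A.card H.card = 2 ^ (survivors A.card H.card - 1) * 2 := by
      rw [← pow_succ, h1]
    simp only [h2]
    ring
  rw [h, sampleMean_pow_survivors, hm]
  have h2 := two_pow_le_three_pow m
  have h3 : (0 : ℝ) < 2 ^ m := by positivity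
  have e1 : ((1 / 2 : ℝ) * 2 + (1 - 1 / 2)) ^ (m + 1) = 3 ^ m / 2 ^ m * (3 / 2) := by
    rw [← div_pow, pow_succ]
    norm_num
  have e2 : (1 - 1 / 2 : ℝ) ^ (m + 1) = 1 / 2 ^ m / 2 := by
    rw [pow_succ, ← one_div_pow]
    norm_num
    ring
  rw [e1, e2, Nat.add_sub_cancel, div_pow]
  have e3 : ((2 : ℝ) ^ (m + 1) - 1) * (1 / 2 ^ m / 2) ≤ 3 ^ m / 2 ^ m / 2 := by
    rw [show (3 : ℝ) ^ m / 2 ^ m / 2 = 3 ^ m * (1 / 2 ^ m / 2) by ring]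
    exact mul_le_mul_of_nonneg_right h2 (by positivity)
  linarith

/-! ### Tail bounds for hubs, survivors and excess -/

section

variable {d : ℕ} {ι : Type*}

/-- Chernoff bound with the moment of `(1 / 2) ^ H.card`. It excludes an empty hub set and also
keeps the point sets from shrinking too fast. -/
theorem card_sample_lower (Q : Finset (Pt d)) {p : ℝ} (hp0 : 0 ≤ p) (hp1 : p ≤ 1) :
    (sampleSubset Q p).toOuterMeasure {H | (H.card : ℝ) < p * Q.card / 4} ≤
      ENNReal.ofReal (Real.exp (-(p * Q.card / 4))) := by
  refine sampleSubset_markov Q hp0 hp1 (fun H => (1 / 2) ^ H.card) (fun H => by positivity)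
    (Real.exp_pos (-(p * Q.card / 4))) _ ?_ ?_
  · intro H _ hH
    have hH' : (H.card : ℝ) < p * Q.card / 4 := hH
    calc Real.exp (-(p * Q.card / 4)) ≤ Real.exp (H.card * (-1)) := by
          rw [Real.exp_le_exp]
          linarith
      _ = Real.exp (-1) ^ H.card := Real.exp_nat_mul _ _
      _ ≤ (1 / 2) ^ H.card := by
          refine pow_le_pow_left₀ (Real.exp_pos _).le ?_ _
          rw [Real.exp_neg, one_div]
          exact inv_anti₀ (by norm_num) (by linarith [Real.exp_one_gt_d9])
  · rw [sampleMean_pow, ← Real.exp_add]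
    calc (p * (1 / 2) + (1 - p)) ^ Q.card ≤ Real.exp (-(p / 2)) ^ Q.card := by
          refine pow_le_pow_left₀ (by linarith) ?_ _
          linarith [Real.one_sub_le_exp_neg (p / 2)]
      _ = _ := by
          rw [← Real.exp_nat_mul]
          ring_nf

theorem sum_card_classes (key : Pt d → ι) (I : Finset ι) (Q : Finset (Pt d))
    (hQ : ∀ x ∈ Q, key x ∈ I) : ∑ k ∈ I, (Q.filter fun x => key x = k).card = Q.card :=
  (Finset.card_eq_sum_card_fiberwise hQ).symm

/-- Each class costs a factor `2 ≤ exp 1` in the moment; together with the deviation `u` this gives,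
after division by the tilt `p`, the term `(N + u) / p`. -/
theorem sum_survivors_upper (key : Pt d → ι) (I : Finset ι) (Q : Finset (Pt d))
    (hQ : ∀ x ∈ Q, key x ∈ I) {p u N : ℝ} (hp0 : 0 < p) (hp1 : p ≤ 1) (hN : I.card ≤ N) :
    (sampleSubset Q p).toOuterMeasure {H | 2 * p * Q.card + (N + u) / p <
        ((∑ k ∈ I, survivors (Q.filter fun x => key x = k).card
          (H.filter fun x => key x = k).card : ℕ) : ℝ)} ≤
      ENNReal.ofReal (Real.exp (-u)) := by
  refine sampleSubset_markov Q hp0.le hp1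
    (fun H => ∏ k ∈ I, Real.exp p ^ survivors (Q.filter fun x => key x = k).card
          (H.filter fun x => key x = k).card) (fun H => by positivity)
    (Real.exp_pos (2 * p ^ 2 * Q.card + N + u)) _ ?_ ?_
  · intro H _ hH
    rw [Finset.prod_pow_eq_pow_sum, ← Real.exp_nat_mul, Real.exp_le_exp]
    have hH' := mul_le_mul_of_nonneg_right (le_of_lt hH) hp0.le
    refine le_trans (le_of_eq ?_) hH'
    field_simp
    ring
  · rw [sampleMean_prod key p (fun k j => Real.exp p ^ survivors
      (Q.filter fun x => key x = k).card j) I Q hQ, ← Real.exp_add]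
    calc _ ≤ ∏ k ∈ I, (2 * Real.exp (2 * p ^ 2 * (Q.filter fun x => key x = k).card)) := by
          refine Finset.prod_le_prod ?_ ?_
          · intro k _
            refine Finset.sum_nonneg fun H _ => ?_
            exact mul_nonneg (mul_nonneg (pow_nonneg hp0.le _) (pow_nonneg (by linarith) _))
              (by positivity)
          · exact fun k _ => sampleMean_exp_survivors_le _ hp0.le hp1
      _ = 2 ^ I.card * Real.exp (2 * p ^ 2 * Q.card) := by
          rw [Finset.prod_mul_distrib, Finset.prod_const, ← Real.exp_sum, ← Finset.mul_sum,
            ← Nat.cast_sum, sum_card_classes key I Q hQ]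
      _ ≤ Real.exp N * Real.exp (2 * p ^ 2 * Q.card) := by
          gcongr
          calc (2 : ℝ) ^ I.card ≤ Real.exp 1 ^ I.card :=
                pow_le_pow_left₀ (by norm_num) (by linarith [Real.exp_one_gt_d9]) _
            _ = Real.exp I.card := by rw [← Real.exp_nat_mul, mul_one]
            _ ≤ Real.exp N := Real.exp_le_exp.2 hN
      _ = _ := by
          rw [← Real.exp_add]
          ring_nf

/-- The number of points of `Q` exceeding one per class. -/
def excess (key : Pt d → ι) (I : Finset ι) (Q : Finset (Pt d)) : ℕ :=
  ∑ k ∈ I, ((Q.filter fun x => key x = k).card - 1)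

theorem sum_excess_upper (key : Pt d → ι) (I : Finset ι) (Q : Finset (Pt d))
    (hQ : ∀ x ∈ Q, key x ∈ I) {u : ℝ} (hu : 0 ≤ u) :
    (sampleSubset Q (1 / 2)).toOuterMeasure {H | (2 / 3 : ℝ) * excess key I Q + 2 * u <
        ((∑ k ∈ I, (survivors (Q.filter fun x => key x = k).card
          (H.filter fun x => key x = k).card - 1) : ℕ) : ℝ)} ≤
      ENNReal.ofReal (Real.exp (-u)) := by
  have hl : 0 < Real.log 2 := Real.log_pos (by norm_num)
  refine sampleSubset_markov Q (by norm_num) (by norm_num)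
    (fun H => ∏ k ∈ I, 2 ^ (survivors (Q.filter fun x => key x = k).card
          (H.filter fun x => key x = k).card - 1)) (fun H => by positivity)
    (Real.exp_pos (((2 / 3 : ℝ) * excess key I Q + 2 * u) * Real.log 2)) _ ?_ ?_
  · intro H _ hH
    have h2 : ∀ m : ℕ, (2 : ℝ) ^ m = Real.exp (m * Real.log 2) := by
      intro m
      rw [Real.exp_nat_mul, Real.exp_log (by norm_num)]
    rw [Finset.prod_pow_eq_pow_sum, h2, Real.exp_le_exp]
    exact mul_le_mul_of_nonneg_right (le_of_lt hH) hl.le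
  · rw [sampleMean_prod key (1 / 2) (fun k j => 2 ^ (survivors
      (Q.filter fun x => key x = k).card j - 1)) I Q hQ, ← Real.exp_add]
    calc _ ≤ ∏ k ∈ I, (3 / 2 : ℝ) ^ ((Q.filter fun x => key x = k).card - 1) := by
          refine Finset.prod_le_prod ?_ ?_
          · intro k _
            refine Finset.sum_nonneg fun H _ => ?_
            positivity
          · exact fun k _ => sampleMean_two_pow_excess_le _
      _ = (3 / 2 : ℝ) ^ excess key I Q := Finset.prod_pow_eq_pow_sum _ _ _
      _ = Real.exp (excess key I Q * Real.log (3 / 2)) := by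
          rw [Real.exp_nat_mul, Real.exp_log (by norm_num)]
      _ ≤ _ := by
          rw [Real.exp_le_exp]
          -- The contraction factor comes from `(3 / 2) ^ 3 ≤ 2 ^ 2`. The slack `2 * u` leaves `2 *
          -- u * log 2 ≥ u` in the exponent.
          have h3 : Real.log (3 / 2) ≤ 2 / 3 * Real.log 2 := by
            have : Real.log ((3 / 2) ^ 3) ≤ Real.log (2 ^ 2) :=
              Real.log_le_log (by norm_num) (by norm_num)
            rw [Real.log_pow, Real.log_pow] at this
            push_cast at this
            linarith
          have h4 : (excess key I Q : ℝ) * Real.log (3 / 2) ≤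
              excess key I Q * (2 / 3 * Real.log 2) := by gcongr
          nlinarith [Real.log_two_gt_d9]

end

section

variable {d : ℕ} {e : Env d}

/-! ### Greedy and the bags -/

theorem Env.mem_of_choose_eq_some (hl : IsListing e.lst) {A : Finset (Pt d)} {x : Pt d}
    (h : e.choose A = some x) : x ∈ A :=
  ((hl A).2 x).1 (List.mem_of_mem_head? h)

theorem Env.choose_isSome (hl : IsListing e.lst) {A : Finset (Pt d)} (hA : A.Nonempty) :
    (e.choose A).isSome := by
  obtain ⟨x, hx⟩ := hA
  rw [Env.choose, List.isSome_head?]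
  intro h
  have := ((hl A).2 x).2 hx
  simp_all

theorem Env.exists_choose_eq_some (hl : IsListing e.lst) {A : Finset (Pt d)} (hA : A.Nonempty) :
    ∃ x ∈ A, e.choose A = some x := by
  obtain ⟨x, hx⟩ := Option.isSome_iff_exists.1 (e.choose_isSome hl hA)
  exact ⟨x, e.mem_of_choose_eq_some hl hx, hx⟩

/-- The output of Greedy contains the start point and is well separated. -/
theorem greedy_spec (hl : IsListing e.lst) (R : Finset (Pt d)) (h : Pt d) (r : ℝ) :
    h ∈ greedy e R h r ∧ greedy e R h r ⊆ insert h R ∧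
      ∀ x ∈ greedy e R h r, ∀ y ∈ greedy e R h r, x ≠ y → 4 * e.c * r < dist x y := by
  unfold greedy
  induction R.card with
  | zero => simp
  | succ m ih =>
    rw [Function.iterate_succ_apply']
    set G := (greedyStep e R r)^[m] {h}
    unfold greedyStep
    split
    · rename_i x hx
      have hx' := e.mem_of_choose_eq_some hl hx
      rw [Finset.mem_filter] at hx'
      have hfar : ∀ y ∈ G, 4 * e.c * r < dist x y := fun y hy =>
        hx'.2.1.trans_le (Metric.infDist_le_dist_of_mem (Finset.mem_coe.2 hy))
      refine ⟨Finset.mem_insert_of_mem ih.1, Finset.insert_subset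
        (Finset.mem_insert_of_mem hx'.1) ih.2.1, ?_⟩
      intro a ha b hb hab
      rw [Finset.mem_insert] at ha hb
      rcases ha with rfl | ha <;> rcases hb with rfl | hb
      · exact absurd rfl hab
      · exact hfar b hb
      · rw [dist_comm]
        exact hfar a ha
      · exact ih.2.2 a ha b hb hab
    · exact ih

/-- Every block contains `h` and its Greedy run starts there. Thus splitting an oversized bag does
not weaken the separation from `h`, the only separation needed when there are hubs. -/
theorem bagCenters_spec (hl : IsListing e.lst) {B : Finset (Pt d)} {h : Pt d} (hB : h ∈ B)
    (r : ℝ) : h ∈ bagCenters e B h r ∧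
      ∀ x ∈ bagCenters e B h r, x = h ∨ x ∈ B ∧ 4 * e.c * r < dist x h := by
  have key : ∀ R : Finset (Pt d), R ⊆ B → ∀ x ∈ greedy e R h r,
      x = h ∨ x ∈ B ∧ 4 * e.c * r < dist x h := by
    intro R hR x hx
    obtain ⟨h1, h2, h3⟩ := greedy_spec hl R h r
    by_cases hxh : x = h
    · exact Or.inl hxh
    · exact Or.inr ⟨hR ((Finset.mem_insert.1 (h2 hx)).resolve_left hxh), h3 x hx h h1 hxh⟩
  unfold bagCenters
  split_ifs with hS
  · exact ⟨(greedy_spec hl B h r).1, key B subset_rfl⟩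
  · constructor
    · rw [Finset.mem_biUnion]
      exact ⟨0, Finset.mem_range.2 (Finset.card_pos.2 ⟨h, hB⟩), (greedy_spec hl _ h r).1⟩
    · intro x hx
      rw [Finset.mem_biUnion] at hx
      obtain ⟨k, -, hx⟩ := hx
      refine key _ ?_ x hx
      refine Finset.insert_subset hB fun y hy => ?_
      rw [List.mem_toFinset] at hy
      exact Finset.mem_of_mem_erase
        (((hl _).2 y).1 (List.mem_of_mem_drop (List.mem_of_mem_take hy)))

/-! ### Nearest-Hub-Search -/

theorem closeHash_eq_some (hl : IsListing e.lst) {H : Finset (Pt d)} {s : ℝ} {f : Pt d → ℕ}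
    {q h : Pt d} (hh : closeHash e H s f q = some h) : h ∈ H ∧ dist q h ≤ e.c * s := by
  have h1 := List.find?_some hh
  have h2 := List.mem_of_mem_take (List.mem_of_find?_eq_some hh)
  exact ⟨(Finset.mem_filter.1 (((hl _).2 h).1 h2)).1, by simpa using h1⟩

/-- If no far hub collides with `q`, the first hub inspected is already close, so the cap of ten
inspections is harmless. -/
theorem closeHash_isSome (hl : IsListing e.lst) {H : Finset (Pt d)} {s : ℝ} {f : Pt d → ℕ}
    {q h : Pt d} (hh : h ∈ H) (hf : f q = f h)
    (hfar : ∀ h ∈ H, e.c * s ≤ dist q h → f q ≠ f h) :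
    ∃ h', closeHash e H s f q = some h' := by
  rw [← Option.isSome_iff_exists, closeHash, List.find?_isSome]
  have h1 : h ∈ e.lst (H.filter fun h => f h = f q) :=
    ((hl _).2 h).2 (Finset.mem_filter.2 ⟨hh, hf.symm⟩)
  rcases hL : e.lst (H.filter fun h => f h = f q) with _ | ⟨a, L⟩
  · simp [hL] at h1
  · refine ⟨a, by simp, ?_⟩
    have h2 : a ∈ H.filter fun h => f h = f q := ((hl _).2 a).1 (by simp [hL])
    rw [Finset.mem_filter] at h2
    rw [decide_eq_true_eq]
    by_contra h3
    exact hfar a h2.1 (not_le.1 h3).le h2.2.symm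

theorem closeScale_eq_some (hl : IsListing e.lst) {H : Finset (Pt d)} {s : ℝ}
    {f : Fin e.hashes → Pt d → ℕ} {q h : Pt d} (hh : closeScale e H s f q = some h) :
    h ∈ H ∧ dist q h ≤ e.c * s := by
  have h1 := e.mem_of_choose_eq_some hl hh
  rw [Finset.mem_filter] at h1
  obtain ⟨l, h2⟩ := h1.2
  exact closeHash_eq_some hl h2

theorem closeScale_exists (hl : IsListing e.lst) {H : Finset (Pt d)} {s : ℝ}
    {f : Fin e.hashes → Pt d → ℕ} {q : Pt d} (l : Fin e.hashes)
    (hh : ∃ h, closeHash e H s (f l) q = some h) : ∃ h, closeScale e H s f q = some h := by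
  obtain ⟨h, hh⟩ := hh
  obtain ⟨x, -, hx⟩ := e.exists_choose_eq_some hl
    (A := H.filter fun h => ∃ l, closeHash e H s (f l) q = some h)
    ⟨h, Finset.mem_filter.2 ⟨(closeHash_eq_some hl hh).1, l, hh⟩⟩
  exact ⟨x, hx⟩

/-- The search takes the smallest successful scale, so success at scale `j` bounds the distance even
when a smaller scale supplies the answer. -/
theorem closeRep_spec (hl : IsListing e.lst) (hc : 0 ≤ e.c) {H : Finset (Pt d)}
    {f : Fin (e.numScales + 1) → Fin e.hashes → Pt d → ℕ} {q : Pt d}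
    (j : Fin (e.numScales + 1))
    (hh : ∃ h, closeScale e H (2 ^ (j : ℕ)) (f j) q = some h) :
    ∃ h, closeRep e H f q = some h ∧ h ∈ H ∧ dist q h ≤ e.c * 2 ^ (j : ℕ) := by
  obtain ⟨h, hh⟩ := hh
  have h1 : (closeRep e H f q).isSome := by
    rw [closeRep, List.findSome?_isSome_iff]
    exact ⟨j, List.mem_finRange j, by rw [hh]; rfl⟩
  obtain ⟨x, hx⟩ := Option.isSome_iff_exists.1 h1
  have h2 := hx
  rw [closeRep, List.findSome?_eq_some_iff] at h2
  obtain ⟨l₁, a, l₂, h3, h4, h5⟩ := h2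
  have h6 := closeScale_eq_some hl h4
  have h7 : a ≤ j := by
    have hj : j ∈ l₁ ++ a :: l₂ := h3 ▸ List.mem_finRange j
    have hs : (l₁ ++ a :: l₂).Pairwise (· < ·) := h3 ▸ List.pairwise_lt_finRange _
    rw [List.mem_append, List.mem_cons] at hj
    rcases hj with hj | rfl | hj
    · have := h5 j hj
      rw [hh] at this
      cases this
    · exact le_rfl
    · rw [List.pairwise_append, List.pairwise_cons] at hs
      exact (hs.2.1.1 j hj).le
  refine ⟨x, hx, h6.1, h6.2.trans ?_⟩
  gcongr
  · norm_num
  · exact h7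

/-- Applied to the distance from a point to its nearest hub: the unit separation of the input places
it within the range of scales, and rounding up to a power of two costs the factor `2` in
`IsNearAssignment`. -/
theorem exists_scale {Δ D : ℝ} (h1 : 1 ≤ D) (h2 : D ≤ Δ) :
    ∃ j : Fin (⌈Real.logb 2 Δ⌉₊ + 1), D ≤ 2 ^ (j : ℕ) ∧ (2 : ℝ) ^ (j : ℕ) ≤ 2 * D := by
  have hj : ⌈Real.logb 2 D⌉₊ < ⌈Real.logb 2 Δ⌉₊ + 1 := by
    rw [Nat.lt_succ_iff]
    exact Nat.ceil_mono (Real.logb_le_logb_of_le (by norm_num) (by linarith) h2)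
  refine ⟨⟨_, hj⟩, ?_, ?_⟩
  · have h3 := Nat.le_ceil (Real.logb 2 D)
    rw [Real.logb_le_iff_le_rpow (by norm_num) (by linarith), Real.rpow_natCast] at h3
    exact h3
  · have h0 : 0 ≤ Real.logb 2 D := Real.logb_nonneg (by norm_num) h1
    have h3 := (Nat.ceil_lt_add_one h0).le
    have h4 : (2 : ℝ) ^ ((⌈Real.logb 2 D⌉₊ : ℕ) : ℝ) ≤ 2 ^ (Real.logb 2 D + 1) :=
      Real.rpow_le_rpow_of_exponent_le (by norm_num) h3
    rw [Real.rpow_natCast, Real.rpow_add (by norm_num), Real.rpow_logb (by norm_num) (by norm_num)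
      (by linarith), Real.rpow_one] at h4
    simp only
    linarith

/-- Each point is assigned to an approximately nearest hub. -/
def IsNearAssignment (e : Env d) (Q H : Finset (Pt d)) (close : Pt d → Pt d) : Prop :=
  ∀ q ∈ Q \ H, close q ∈ H ∧ ∀ h ∈ H, dist q (close q) ≤ 2 * e.c * dist q h

theorem prob_hash_fail_le {ℋ : PMF (Pt d → ℕ)} {s c p₁ p₂ : ℝ} (hℋ : IsLSH ℋ s (c * s) p₁ p₂)
    (H : Finset (Pt d)) (hp₂ : 0 ≤ p₂) {q h : Pt d} (hq : dist q h ≤ s) :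
    prob ℋ {f | f q = f h ∧ ∀ h ∈ H, c * s ≤ dist q h → f q ≠ f h}ᶜ ≤
      1 - (p₁ - H.card * p₂) := by
  rw [prob_compl]
  set S : Set (Pt d → ℕ) := {f | f q = f h ∧ ∀ h ∈ H, c * s ≤ dist q h → f q ≠ f h}
  have h1 : {f : Pt d → ℕ | f q = f h} ⊆ S ∪ ⋃ x ∈ H.filter fun x => c * s ≤ dist q x,
      {f : Pt d → ℕ | f q = f x} := by
    intro f hf
    by_cases hfS : f ∈ S
    · exact Or.inl hfS
    · right
      have : ∃ x ∈ H, c * s ≤ dist q x ∧ f q = f x := by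
        by_contra hcon
        push Not at hcon
        exact hfS ⟨hf, hcon⟩
      obtain ⟨x, hx, hx1, hx2⟩ := this
      simp only [Set.mem_iUnion]
      exact ⟨x, Finset.mem_filter.2 ⟨hx, hx1⟩, hx2⟩
  have h2 := (hℋ.near q h hq).trans ((prob_mono ℋ h1).trans (prob_union_le _ _ _))
  have h3 : prob ℋ (⋃ x ∈ H.filter fun x => c * s ≤ dist q x, {f : Pt d → ℕ | f q = f x}) ≤
      H.card * p₂ := by
    refine (prob_biUnion_le _ _ _).trans ?_
    refine (Finset.sum_le_card_nsmul _ _ p₂ fun x hx =>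
      hℋ.far q x (Finset.mem_filter.1 hx).2).trans ?_
    rw [nsmul_eq_mul]
    gcongr
    exact Finset.filter_subset _ _
  linarith

/-- For each point only the scale just above its nearest-hub distance matters. The final choice
among repetitions is arbitrary, so every repetition must succeed at that scale; hence the factor
`e.reps` in the union bound. -/
theorem nearestHubSearch_fails_le (hl : IsListing e.lst) (hc : 0 < e.c) (hreps : 0 < e.reps)
    {p₁ p₂ : ℝ} (hp₂ : 0 ≤ p₂) (hℋ : ∀ s, 0 < s → IsLSH (e.hash s) s (e.c * s) p₁ p₂)
    {Q H : Finset (Pt d)} (hHQ : H ⊆ Q) (hH : H.Nonempty)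
    (hsep : ∀ x ∈ Q, ∀ y ∈ Q, x ≠ y → 1 ≤ dist x y) (hΔ : ∀ x ∈ Q, ∀ y ∈ Q, dist x y ≤ e.Δ) :
    fails (nearestHubSearch e Q H) (IsNearAssignment e Q H) ≤
      ENNReal.ofReal (Q.card * (e.reps * (1 - (p₁ - H.card * p₂)) ^ e.hashes)) := by
  have hnear : ∀ q : Pt d, ∃ h ∈ H, ∀ h' ∈ H, dist q h ≤ dist q h' := fun q =>
    H.exists_min_image (fun h => dist q h) hH
  choose hub hubH hubmin using hnear
  have hscale : ∀ q : Pt d, ∃ j : Fin (e.numScales + 1), q ∈ Q \ H →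
      dist q (hub q) ≤ 2 ^ (j : ℕ) ∧ (2 : ℝ) ^ (j : ℕ) ≤ 2 * dist q (hub q) := by
    intro q
    by_cases hq : q ∈ Q \ H
    · rw [Finset.mem_sdiff] at hq
      obtain ⟨j, hj⟩ := exists_scale
        (hsep q hq.1 (hub q) (hHQ (hubH q)) fun h => hq.2 (h ▸ hubH q))
        (hΔ q hq.1 (hub q) (hHQ (hubH q)))
      exact ⟨j, fun _ => hj⟩
    · exact ⟨0, fun h => absurd h hq⟩
  choose j hj using hscale
  set good : Pt d → Set (Pt d → ℕ) := fun q => {f | f q = f (hub q) ∧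
    ∀ h ∈ H, e.c * 2 ^ (j q : ℕ) ≤ dist q h → f q ≠ f h} with hgood
  have hdet : ∀ f : Fin e.reps → Fin (e.numScales + 1) → Fin e.hashes → Pt d → ℕ,
      (∀ q ∈ Q \ H, ∀ i, ∃ l, f i (j q) l ∈ good q) →
      ∀ q ∈ Q \ H, ∃ x, closeHub e H f q = some x ∧ x ∈ H ∧
        ∀ h ∈ H, dist q x ≤ 2 * e.c * dist q h := by
    intro f hf q hq
    have h1 : ∀ i, ∃ h, closeRep e H (f i) q = some h ∧ h ∈ H ∧
        dist q h ≤ e.c * 2 ^ (j q : ℕ) := by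
      intro i
      obtain ⟨l, hl1, hl2⟩ := hf q hq i
      exact closeRep_spec hl hc.le (j q) (closeScale_exists hl l
        (closeHash_isSome hl (hubH q) hl1 hl2))
    obtain ⟨h0, h01, h02, -⟩ := h1 ⟨0, hreps⟩
    obtain ⟨x, hx1, hx2⟩ := e.exists_choose_eq_some hl
      (A := H.filter fun h => ∃ i, closeRep e H (f i) q = some h)
      ⟨h0, Finset.mem_filter.2 ⟨h02, _, h01⟩⟩
    rw [Finset.mem_filter] at hx1
    refine ⟨x, hx2, hx1.1, fun h hh => ?_⟩
    obtain ⟨i, hi⟩ := hx1.2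
    obtain ⟨y, hy1, -, hy2⟩ := h1 i
    rw [hi, Option.some.injEq] at hy1
    subst hy1
    calc dist q x ≤ e.c * 2 ^ (j q : ℕ) := hy2
      _ ≤ e.c * (2 * dist q (hub q)) := by
          gcongr
          exact (hj q hq).2
      _ ≤ e.c * (2 * dist q h) := by
          gcongr
          exact hubmin q h hh
      _ = _ := by ring
  unfold fails nearestHubSearch
  rw [PMF.toOuterMeasure_map_apply, ← ofReal_prob]
  refine ENNReal.ofReal_le_ofReal ?_
  have hsub : ∀ f : Fin e.reps → Fin (e.numScales + 1) → Fin e.hashes → Pt d → ℕ,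
      (∀ a, (if ∀ q ∈ Q \ H, (closeHub e H f q).isSome then
        some fun q => (closeHub e H f q).getD q else none) = some a →
          ¬ IsNearAssignment e Q H a) →
      f ∈ ⋃ q ∈ Q \ H, ⋃ i ∈ (Finset.univ : Finset (Fin e.reps)),
        {f : Fin e.reps → Fin (e.numScales + 1) → Fin e.hashes → Pt d → ℕ |
          f i ∈ {g : Fin (e.numScales + 1) → Fin e.hashes → Pt d → ℕ |
            g (j q) ∈ {w : Fin e.hashes → Pt d → ℕ | ∀ l, w l ∈ (good q)ᶜ}}} := by
    intro f hf
    by_contra hcon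
    simp only [Set.mem_iUnion, Set.mem_ofPred_eq, not_exists, not_forall, Finset.mem_univ,
      Set.mem_compl_iff, not_not] at hcon
    have h1 := hdet f fun q hq i => hcon q hq i trivial
    have h2 : ∀ q ∈ Q \ H, (closeHub e H f q).isSome := by
      intro q hq
      obtain ⟨x, hx, -⟩ := h1 q hq
      rw [hx]
      rfl
    rw [if_pos h2] at hf
    refine hf _ rfl fun q hq => ?_
    obtain ⟨x, hx, hx2⟩ := h1 q hq
    simp only [hx, Option.getD_some]
    exact hx2
  refine (prob_mono _ (t := ⋃ q ∈ Q \ H, ⋃ i ∈ (Finset.univ : Finset (Fin e.reps)),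
        {f : Fin e.reps → Fin (e.numScales + 1) → Fin e.hashes → Pt d → ℕ |
          f i ∈ {g : Fin (e.numScales + 1) → Fin e.hashes → Pt d → ℕ |
            g (j q) ∈ {w : Fin e.hashes → Pt d → ℕ | ∀ l, w l ∈ (good q)ᶜ}}})
        fun f hf => hsub f hf).trans ?_
  have hone : ∀ q ∈ Q \ H, prob (e.hash (2 ^ (j q : ℕ))) (good q)ᶜ ≤
      1 - (p₁ - H.card * p₂) := fun q hq =>
    prob_hash_fail_le (hℋ _ (by positivity)) H hp₂ (hj q hq).1
  -- The base of the power must be nonnegative. This holds because it bounds a probability; if no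
  -- point needs a hub, a hub paired with itself serves as the witness.
  by_cases hQH : (Q \ H).Nonempty
  swap
  · rw [Finset.not_nonempty_iff_eq_empty] at hQH
    obtain ⟨q, hq⟩ := hH
    have h0 : prob (e.hash 1) {f | f q = f q ∧
        ∀ h ∈ H, e.c * 1 ≤ dist q h → f q ≠ f h}ᶜ ≤ 1 - (p₁ - H.card * p₂) :=
      prob_hash_fail_le (hℋ 1 one_pos) H hp₂ (by simp)
    have h1 := (prob_nonneg _ _).trans h0
    rw [hQH]
    refine le_trans (le_of_eq ?_) (mul_nonneg (Nat.cast_nonneg _)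
      (mul_nonneg (Nat.cast_nonneg _) (pow_nonneg h1 _)))
    simp [prob]
  obtain ⟨q₀, hq₀⟩ := hQH
  have hnn := (prob_nonneg _ _).trans (hone q₀ hq₀)
  refine (prob_biUnion_le _ _ _).trans ?_
  refine (Finset.sum_le_card_nsmul _ _
    (e.reps * (1 - (p₁ - H.card * p₂)) ^ e.hashes) fun q hq => ?_).trans ?_
  · refine (prob_biUnion_le _ _ _).trans ?_
    refine (Finset.sum_le_card_nsmul _ _ ((1 - (p₁ - H.card * p₂)) ^ e.hashes)
      fun i _ => ?_).trans ?_
    · rw [prob_indep_marginal, prob_indep_marginal, prob_indep_pi]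
      rw [Finset.prod_const, Finset.card_univ, Fintype.card_fin]
      exact pow_le_pow_left₀ (prob_nonneg _ _) (hone q hq) _
    · rw [Finset.card_univ, Fintype.card_fin, nsmul_eq_mul]
  · rw [nsmul_eq_mul]
    gcongr
    exact Finset.sdiff_subset

/-! ### Sample-And-Solve -/

/-- Separates chance from geometry. Outside a bad hub set and a failed search, the output contains
all hubs, and no non-hub of the output shares a class with a hub. If everything fits into local
space, Greedy keeps at most one point per class. -/
theorem sampleAndSolve_fails_le {ι : Type*} (hl : IsListing e.lst) (hc : 1 < e.c) {r : ℝ}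
    (hr : 0 < r) {Q : Finset (Pt d)} {key : Pt d → ι}
    (hkey : ∀ x ∈ Q, ∀ y ∈ Q, key x = key y → dist x y ≤ 2 * r) {ε η : ℝ≥0∞}
    (hsearch : ∀ H ⊆ Q, H.Nonempty →
      fails (nearestHubSearch e Q H) (IsNearAssignment e Q H) ≤ η)
    {p : ℝ} (bad : Set (Finset (Pt d)))
    (hbad : e.S < Q.card → (sampleSubset Q p).toOuterMeasure bad ≤ ε)
    (hne : e.S < Q.card → ∅ ∈ bad) {Ψ : Finset (Pt d) → Prop}
    (hsmall : Q.card ≤ e.S → ∀ T ⊆ Q, (∀ x ∈ T, ∀ y ∈ T, key x = key y → x = y) → Ψ T)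
    (hlarge : e.S < Q.card → ∀ H ⊆ Q, H ∉ bad → ∀ T ⊆ Q, H ⊆ T →
      (∀ x ∈ T, x ∉ H → ∀ h ∈ H, key h ≠ key x) → Ψ T) :
    fails (sampleAndSolve e Q p r) Ψ ≤ ε + η := by
  have hcr : 2 * r < 4 * e.c * r := by nlinarith
  unfold sampleAndSolve
  split_ifs with hS
  · refine fails_pure_some ?_
    split
    · rename_i q hq
      have hqQ := e.mem_of_choose_eq_some hl hq
      obtain ⟨h1, h2, h3⟩ := greedy_spec hl Q q r
      rw [Finset.insert_eq_of_mem hqQ] at h2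
      refine hsmall hS _ h2 fun x hx y hy hxy => ?_
      by_contra hne
      have := h3 x hx y hy hne
      have := hkey x (h2 hx) y (h2 hy) hxy
      linarith
    · exact hsmall hS _ (Finset.empty_subset _) (by simp)
  · rw [not_le] at hS
    refine outer_bind_le _ _ bad _ (hbad hS) ?_
    intro H hH hHbad
    have hHQ := mem_support_sampleSubset hH
    have hHne : H ≠ ∅ := fun h => hHbad (h ▸ hne hS)
    rw [if_neg hHne, PMF.toOuterMeasure_map_apply]
    refine le_trans (MeasureTheory.measure_mono ?_)
      (hsearch H hHQ (Finset.nonempty_iff_ne_empty.2 hHne))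
    rintro o ho close rfl hclose
    refine ho _ rfl ?_
    have hbag := fun h => bagCenters_spec hl (r := r) (B := insert h ((Q \ H).filter
      fun q => close q = h)) (Finset.mem_insert_self h _)
    refine hlarge hS H hHQ hHbad _ ?_ ?_ ?_
    · intro x hx
      rw [Finset.mem_biUnion] at hx
      obtain ⟨h, hh, hx⟩ := hx
      rcases (hbag h).2 x hx with rfl | ⟨h1, -⟩
      · exact hHQ hh
      · rcases Finset.mem_insert.1 h1 with rfl | h2
        · exact hHQ hh
        · exact (Finset.mem_sdiff.1 (Finset.mem_filter.1 h2).1).1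
    · intro h hh
      exact Finset.mem_biUnion.2 ⟨h, hh, (hbag h).1⟩
    · intro x hx hxH h' hh' hkey'
      rw [Finset.mem_biUnion] at hx
      obtain ⟨h, hh, hx⟩ := hx
      rcases (hbag h).2 x hx with rfl | ⟨h1, h2⟩
      · exact hxH hh
      · rcases Finset.mem_insert.1 h1 with rfl | h3
        · exact hxH hh
        · rw [Finset.mem_filter] at h3
          -- A hub in the class of `x` lies within `2 * r`, so the assigned hub of `x` lies within
          -- `2 * c * (2 * r)`, exactly the threshold at which Greedy discards `x`.
          have h4 := (hclose x h3.1).2 h' hh'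
          rw [h3.2] at h4
          have h5 := hkey x (Finset.mem_sdiff.1 h3.1).1 h' (hHQ hh') hkey'.symm
          nlinarith

section

variable {ι : Type*} {key : Pt d → ι}

theorem card_class_le_survivors {Q H T : Finset (Pt d)} (hTQ : T ⊆ Q)
    (h : ∀ x ∈ T, x ∉ H → ∀ h ∈ H, key h ≠ key x) (k : ι) :
    (T.filter fun x => key x = k).card ≤
      survivors (Q.filter fun x => key x = k).card (H.filter fun x => key x = k).card := by
  unfold survivors
  split_ifs with h0
  · exact Finset.card_le_card (Finset.filter_subset_filter _ hTQ)
  · obtain ⟨y, hy⟩ := Finset.card_pos.1 (Nat.pos_of_ne_zero h0)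
    rw [Finset.mem_filter] at hy
    refine Finset.card_le_card fun x hx => ?_
    rw [Finset.mem_filter] at hx ⊢
    refine ⟨?_, hx.2⟩
    by_contra hxH
    exact h x hx.1 hxH y hy.1 (hy.2.trans hx.2.symm)

theorem card_class_le_one {T : Finset (Pt d)}
    (h : ∀ x ∈ T, ∀ y ∈ T, key x = key y → x = y) (k : ι) :
    (T.filter fun x => key x = k).card ≤ 1 := by
  rw [Finset.card_le_one]
  intro x hx y hy
  rw [Finset.mem_filter] at hx hy
  exact h x hx.1 y hy.1 (hx.2.trans hy.2.symm)

/-- One round of the uniform center algorithm. -/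
theorem sampleAndSolve_uniform (hl : IsListing e.lst) (hc : 1 < e.c) {r : ℝ} (hr : 0 < r)
    {Q : Finset (Pt d)} (I : Finset ι) (hI : ∀ x ∈ Q, key x ∈ I)
    (hkey : ∀ x ∈ Q, ∀ y ∈ Q, key x = key y → dist x y ≤ 2 * r) {η : ℝ} (hη : 0 ≤ η)
    (hsearch : ∀ H ⊆ Q, H.Nonempty →
      fails (nearestHubSearch e Q H) (IsNearAssignment e Q H) ≤ ENNReal.ofReal η)
    {p u v N : ℝ} (hp0 : 0 < p) (hp1 : p ≤ 1) (hu : 0 ≤ u) (hN : I.card ≤ N) (hv : 0 < v)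
    (hQv : e.S < Q.card → v ≤ p * Q.card / 4) :
    fails (sampleAndSolve e Q p r) (fun T => T ⊆ Q ∧
      (T.card ≤ e.S ∨ p * Q.card / 4 ≤ T.card) ∧ T.card ≤ 2 * p * Q.card + (N + u) / p) ≤
      ENNReal.ofReal (Real.exp (-v) + Real.exp (-u) + η) := by
  have hN0 : (0 : ℝ) ≤ N := (Nat.cast_nonneg _).trans hN
  rw [ENNReal.ofReal_add (by positivity) hη]
  refine sampleAndSolve_fails_le hl hc hr hkey hsearch
    ({H | (H.card : ℝ) < p * Q.card / 4} ∪ {H | 2 * p * Q.card + (N + u) / p <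
        ((∑ k ∈ I, survivors (Q.filter fun x => key x = k).card
          (H.filter fun x => key x = k).card : ℕ) : ℝ)}) ?_ ?_ ?_ ?_
  · intro hS
    refine (MeasureTheory.measure_union_le _ _).trans ?_
    rw [ENNReal.ofReal_add (by positivity) (by positivity)]
    refine add_le_add ((card_sample_lower Q hp0.le hp1).trans (ENNReal.ofReal_le_ofReal ?_))
      (sum_survivors_upper key I Q hI hp0 hp1 hN)
    rw [Real.exp_le_exp]
    linarith [hQv hS]
  · intro hS
    -- The empty sample violates the lower tail bound because `0 < v ≤ p * Q.card / 4`.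
    left
    simp only [Set.mem_ofPred_eq, Finset.card_empty, Nat.cast_zero]
    linarith [hQv hS]
  · intro hS T hT hinj
    refine ⟨hT, Or.inl ((Finset.card_le_card hT).trans hS), ?_⟩
    have h1 : T.card ≤ I.card := by
      rw [← sum_card_classes key I T fun x hx => hI x (hT hx)]
      calc _ ≤ ∑ k ∈ I, 1 := Finset.sum_le_sum fun k _ => card_class_le_one hinj k
        _ = _ := by simp
    have h2 : (T.card : ℝ) ≤ N := le_trans (by exact_mod_cast h1) hN
    have h3 : N + u ≤ (N + u) / p := by
      rw [le_div_iff₀ hp0]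
      nlinarith
    have h4 : 0 ≤ 2 * p * Q.card := by positivity
    linarith
  · intro hS H hH hbad T hT hHT hkill
    simp only [Set.mem_union, Set.mem_ofPred_eq, not_or, not_lt] at hbad
    have h0 : (H.card : ℝ) ≤ T.card := by exact_mod_cast Finset.card_le_card hHT
    refine ⟨hT, Or.inr (hbad.1.trans h0), le_trans ?_ hbad.2⟩
    rw [← sum_card_classes key I T fun x hx => hI x (hT hx)]
    exact_mod_cast Finset.sum_le_sum fun k _ => card_class_le_survivors hT hkill k

/-- One round with sampling probability `1 / 2`. -/
theorem sampleAndSolve_half (hl : IsListing e.lst) (hc : 1 < e.c) {r : ℝ} (hr : 0 < r)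
    {Q : Finset (Pt d)} (I : Finset ι) (hI : ∀ x ∈ Q, key x ∈ I)
    (hkey : ∀ x ∈ Q, ∀ y ∈ Q, key x = key y → dist x y ≤ 2 * r) {η : ℝ} (hη : 0 ≤ η)
    (hsearch : ∀ H ⊆ Q, H.Nonempty →
      fails (nearestHubSearch e Q H) (IsNearAssignment e Q H) ≤ ENNReal.ofReal η)
    {u v : ℝ} (hu : 0 ≤ u) (hv : 0 < v) (hQv : e.S < Q.card → v ≤ Q.card / 8) :
    fails (sampleAndSolve e Q (1 / 2) r) (fun T => T ⊆ Q ∧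
      (excess key I T : ℝ) ≤ 2 / 3 * excess key I Q + 2 * u) ≤
      ENNReal.ofReal (Real.exp (-v) + Real.exp (-u) + η) := by
  rw [ENNReal.ofReal_add (by positivity) hη]
  refine sampleAndSolve_fails_le hl hc hr hkey hsearch
    ({H | (H.card : ℝ) < 1 / 2 * Q.card / 4} ∪ {H | (2 / 3 : ℝ) * excess key I Q + 2 * u <
        ((∑ k ∈ I, (survivors (Q.filter fun x => key x = k).card
          (H.filter fun x => key x = k).card - 1) : ℕ) : ℝ)}) ?_ ?_ ?_ ?_
  · intro hS
    refine (MeasureTheory.measure_union_le _ _).trans ?_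
    rw [ENNReal.ofReal_add (by positivity) (by positivity)]
    refine add_le_add ((card_sample_lower Q (by norm_num) (by norm_num)).trans
      (ENNReal.ofReal_le_ofReal ?_)) (sum_excess_upper key I Q hI hu)
    rw [Real.exp_le_exp]
    linarith [hQv hS]
  · intro hS
    left
    simp only [Set.mem_ofPred_eq, Finset.card_empty, Nat.cast_zero]
    linarith [hQv hS]
  · intro hS T hT hinj
    refine ⟨hT, ?_⟩
    have h1 : excess key I T = 0 := by
      refine Finset.sum_eq_zero fun k _ => ?_
      have := card_class_le_one hinj k
      omega
    rw [h1, Nat.cast_zero]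
    positivity
  · intro hS H hH hbad T hT hHT hkill
    simp only [Set.mem_union, Set.mem_ofPred_eq, not_or, not_lt] at hbad
    refine ⟨hT, le_trans ?_ hbad.2⟩
    exact_mod_cast Finset.sum_le_sum fun k _ =>
      Nat.sub_le_sub_right (card_class_le_survivors hT hkill k) 1

end

end

/-! ### Growth estimates -/

/-- The properties of large real numbers that the analysis uses. -/
structure IsLarge (d : ℕ) (ρ δ σ ω kP ε x : ℝ) : Prop where
  two_le_log : 2 ≤ Real.log x
  rec_le : 2 * x * Real.log (2 * x) ^ (d + 2) ≤ x ^ 2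
  search : x * ((Real.log x + 1) * Real.exp (-(x ^ (ρ / 2) / 2))) ≤ 1 / x
  prob_le : kP * Real.log x / x ^ δ ≤ 1
  space : 4 * Real.log x * Real.log x ≤ σ * x ^ δ
  space_gap : 4 * Real.log x ≤ σ * x ^ ε
  centers : ∀ y, Real.log x ≤ y →
    4 * Real.exp 2 * ((2 * d + 5) ^ d * y ^ d + 1 / ω) ≤ y ^ (d + 2)
  rounds : ∀ y, x ≤ y → 3 * (2 * Real.log (Real.log y) + 1) ≤ √y
  shrink : 4 * Real.log x ^ 2 ≤ x
  total : 2 / √x + 3 * (9 * Real.log (Real.log x) + 1) / x ≤ 1 / x ^ (1 / 4 : ℝ)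

theorem eventually_log_le {a b : ℝ} (ha : 0 < a) (hb : 0 < b) :
    ∀ᶠ x : ℝ in Filter.atTop, a * Real.log x ≤ x ^ b := by
  filter_upwards [(isLittleO_log_rpow_atTop hb).bound (inv_pos.2 ha),
    Filter.eventually_ge_atTop 1] with x hx hx1
  rw [Real.norm_of_nonneg (Real.log_nonneg hx1),
    Real.norm_of_nonneg (Real.rpow_nonneg (by linarith) _), inv_mul_eq_div, le_div_iff₀ ha] at hx
  linarith

theorem eventually_log_pow_le (m : ℕ) {a : ℝ} (ha : 0 < a) :
    ∀ᶠ x : ℝ in Filter.atTop, Real.log x ^ m ≤ a * x := by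
  filter_upwards [(Real.isLittleO_pow_log_id_atTop (n := m)).bound ha,
    Filter.eventually_ge_atTop 1] with x hx hx1
  rw [Real.norm_of_nonneg (pow_nonneg (Real.log_nonneg hx1) _), id,
    Real.norm_of_nonneg (by linarith)] at hx
  exact hx

/-- The fields `centers` and `rounds` range over all larger arguments because `t_j` is known only to
lie between the `j`-th iterated logarithm and its square. -/
theorem eventually_isLarge (d : ℕ) {ρ δ σ ω kP ε : ℝ} (hρ : 0 < ρ) (hδ : 0 < δ) (hσ : 0 < σ)
    (hω : 0 < ω) (hkP : 0 < kP) (hε : 0 < ε) :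
    ∀ᶠ x : ℝ in Filter.atTop, IsLarge d ρ δ σ ω kP ε x := by
  have h2x : Filter.Tendsto (fun x : ℝ => 2 * x) Filter.atTop Filter.atTop :=
    Filter.tendsto_id.const_mul_atTop two_pos
  have hround : ∀ᶠ x : ℝ in Filter.atTop, ∀ y, x ≤ y →
      3 * (2 * Real.log (Real.log y) + 1) ≤ √y := by
    rw [Filter.eventually_forall_ge_atTop]
    filter_upwards [eventually_log_le (a := 9) (by norm_num) one_half_pos,
      Real.tendsto_log_atTop.eventually_ge_atTop 1] with y hy hy1
    rw [Real.sqrt_eq_rpow]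
    have := Real.log_le_sub_one_of_pos (x := Real.log y) (by linarith)
    linarith
  filter_upwards [Real.tendsto_log_atTop.eventually_ge_atTop 2,
    h2x.eventually (eventually_log_pow_le (d + 2) (a := 1 / 4) (by norm_num)),
    eventually_log_le (a := 6) (by norm_num) (half_pos hρ),
    eventually_log_le hkP hδ,
    eventually_log_le (a := 2 / √σ) (by positivity) (half_pos hδ),
    eventually_log_le (a := 4 / σ) (by positivity) hε,
    Real.tendsto_log_atTop.eventually_ge_atTop
      (4 * Real.exp 2 * ((2 * d + 5) ^ d + 1 / ω) + 1),
    hround, eventually_log_pow_le 2 (a := 1 / 4) (by norm_num),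
    eventually_log_le (a := 30) (by norm_num) one_half_pos,
    Filter.eventually_ge_atTop 81] with x h1 h2 h3 h4 h5 h6 h7 h8 h9 h10 h11
  have hx : 0 < x := by linarith
  refine ⟨h1, ?_, ?_, ?_, ?_, ?_, ?_, h8, by linarith, ?_⟩
  · nlinarith
  · have e1 : Real.log x + 1 ≤ x := by linarith [Real.log_le_sub_one_of_pos hx]
    rw [le_div_iff₀ hx]
    calc x * ((Real.log x + 1) * Real.exp (-(x ^ (ρ / 2) / 2))) * x
        ≤ x * (x * Real.exp (-(x ^ (ρ / 2) / 2))) * x := by gcongr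
      _ = Real.exp (Real.log x * 3) * Real.exp (-(x ^ (ρ / 2) / 2)) := by
          have : Real.exp (Real.log x * 3) = x ^ 3 := by
            rw [mul_comm, ← Nat.cast_ofNat, Real.exp_nat_mul, Real.exp_log hx]
          rw [this]
          ring
      _ ≤ 1 := by
          rw [← Real.exp_add, Real.exp_le_one_iff]
          linarith
  · rwa [div_le_one (by positivity)]
  · have e1 : (2 / √σ * Real.log x) ^ 2 ≤ (x ^ (δ / 2)) ^ 2 :=
      pow_le_pow_left₀ (mul_nonneg (by positivity) (by linarith)) h5 2
    rw [← Real.rpow_natCast (x ^ (δ / 2)), ← Real.rpow_mul hx.le, mul_pow, div_pow,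
      Real.sq_sqrt hσ.le, div_mul_eq_mul_div, div_le_iff₀ hσ] at e1
    push_cast at e1
    rw [div_mul_cancel₀ _ (by norm_num)] at e1
    linarith
  · rw [div_mul_eq_mul_div, div_le_iff₀ hσ] at h6
    linarith
  · intro y hy
    have e0 : 0 < 4 * Real.exp 2 * ((2 * d + 5) ^ d + 1 / ω) := by positivity
    have e1 : 1 ≤ y := by linarith
    have e2 : 1 ≤ y ^ d := one_le_pow₀ e1
    have e3 : 0 < 1 / ω := by positivity
    calc 4 * Real.exp 2 * ((2 * d + 5) ^ d * y ^ d + 1 / ω)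
        ≤ 4 * Real.exp 2 * ((2 * d + 5) ^ d * y ^ d + 1 / ω * y ^ d) := by
          gcongr
          nlinarith
      _ = 4 * Real.exp 2 * ((2 * d + 5) ^ d + 1 / ω) * y ^ d := by ring
      _ ≤ y ^ 2 * y ^ d := by
          gcongr
          nlinarith
      _ = y ^ (d + 2) := by ring
  · have e1 : Real.log (Real.log x) ≤ Real.log x := by
      have := Real.log_le_sub_one_of_pos (x := Real.log x) (by linarith)
      linarith
    have e2 : 3 * (9 * Real.log (Real.log x) + 1) ≤ √x := by
      rw [Real.sqrt_eq_rpow]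
      linarith
    have e3 : (x ^ (1 / 4 : ℝ)) * x ^ (1 / 4 : ℝ) = √x := by
      rw [← Real.rpow_add hx, Real.sqrt_eq_rpow]
      norm_num
    have e4 : (3 : ℝ) ≤ x ^ (1 / 4 : ℝ) := by
      calc (3 : ℝ) = 81 ^ (1 / 4 : ℝ) := by
            rw [show (81 : ℝ) = 3 ^ (4 : ℝ) by norm_num, ← Real.rpow_mul (by norm_num)]
            norm_num
        _ ≤ _ := Real.rpow_le_rpow (by norm_num) h11 (by norm_num)
    have e5 : 0 < √x := Real.sqrt_pos.2 hx
    have e6 : √x / x = 1 / √x := by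
      rw [div_eq_div_iff hx.ne' e5.ne', Real.mul_self_sqrt hx.le, one_mul]
    calc 2 / √x + 3 * (9 * Real.log (Real.log x) + 1) / x ≤ 2 / √x + √x / x := by gcongr
      _ = 3 / √x := by
          rw [e6]
          ring
      _ ≤ 1 / x ^ (1 / 4 : ℝ) := by
          rw [← e3, div_le_div_iff₀ (by positivity) (by positivity)]
          nlinarith

theorem IsLarge.pos {d : ℕ} {ρ δ σ ω kP ε x : ℝ} (h : IsLarge d ρ δ σ ω kP ε x) (hx : 0 ≤ x) :
    1 < x := by
  by_contra hcon
  have := Real.log_nonpos hx (not_lt.1 hcon)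
  linarith [h.two_le_log]

/-! ### Iterated logarithms -/

theorem iterLog_zero (x : ℝ) : iterLog 0 x = x := rfl

theorem iterLog_succ (k : ℕ) (x : ℝ) : iterLog (k + 1) x = Real.log (iterLog k x) :=
  Function.iterate_succ_apply' _ _ _

theorem one_lt_iterLog_of_lt_logStar {x : ℝ} {k : ℕ} (h : k < logStar x) : 1 < iterLog k x := by
  by_contra hcon
  have h1 : logStar x ≤ k := Nat.sInf_le (not_lt.1 hcon)
  omega

/-- Since `log y ≤ y - 1`, each remaining application of `log` accounts for at least one unit. A
constant gap below `logStar` thus makes all iterated logarithms in use as large as desired. -/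
theorem le_iterLog_of_add_le_logStar {x : ℝ} {c : ℕ} :
    ∀ {k : ℕ}, k + (c + 1) ≤ logStar x → (c : ℝ) + 1 ≤ iterLog k x := by
  induction c with
  | zero =>
    intro k h
    have := one_lt_iterLog_of_lt_logStar (x := x) (k := k) (by omega)
    push_cast
    linarith
  | succ c ih =>
    intro k h
    have h1 := ih (k := k + 1) (by omega)
    have h2 := one_lt_iterLog_of_lt_logStar (x := x) (k := k) (by omega)
    rw [iterLog_succ] at h1
    have := Real.log_le_sub_one_of_pos (x := iterLog k x) (by linarith)
    push_cast
    linarith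

section

variable {d : ℕ} {ρ δ σ ω kP ε : ℝ} {n α : ℕ}

/-- Squaring the argument only doubles its logarithm, and the additional power of `log log` fits
below the next square by `rec_le`. -/
theorem tSeq_bounds (h : ∀ j ≤ α, IsLarge d ρ δ σ ω kP ε (iterLog j n))
    (hpos : ∀ j ≤ α, 1 < iterLog j n) :
    ∀ j ≤ α, iterLog j n ≤ tSeq d 1 n j ∧ tSeq d 1 n j ≤ iterLog j n ^ 2 := by
  intro j
  induction j with
  | zero =>
    intro _
    have := hpos 0 (Nat.zero_le _)
    rw [iterLog_zero] at this ⊢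
    simp only [tSeq]
    exact ⟨le_rfl, by nlinarith⟩
  | succ j ih =>
    intro hj
    obtain ⟨h1, h2⟩ := ih (by omega)
    have hp := hpos j (by omega)
    have hL := h (j + 1) hj
    have hlog1 : iterLog (j + 1) n ≤ Real.log (tSeq d 1 n j) := by
      rw [iterLog_succ]
      exact Real.log_le_log (by linarith) h1
    have hlog2 : Real.log (tSeq d 1 n j) ≤ 2 * iterLog (j + 1) n := by
      rw [iterLog_succ]
      refine (Real.log_le_log (by linarith) h2).trans ?_
      rw [Real.log_pow]
      norm_num
    have hp1 := hpos (j + 1) hj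
    have hll1 : 1 ≤ Real.log (Real.log (tSeq d 1 n j)) := by
      have := Real.log_le_log (by linarith) hlog1
      linarith [hL.two_le_log]
    have hll2 : Real.log (Real.log (tSeq d 1 n j)) ≤ Real.log (2 * iterLog (j + 1) n) :=
      Real.log_le_log (by linarith) hlog2
    simp only [tSeq, one_mul]
    constructor
    · have := one_le_pow₀ hll1 (n := d + 2)
      nlinarith
    · refine le_trans ?_ hL.rec_le
      gcongr

theorem tSeq_shrink (h : ∀ j ≤ α, IsLarge d ρ δ σ ω kP ε (iterLog j n))
    (hpos : ∀ j ≤ α, 1 < iterLog j n) {j : ℕ} (hj : j + 1 ≤ α) :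
    4 * tSeq d 1 n (j + 1) ≤ tSeq d 1 n j := by
  have h1 := (tSeq_bounds h hpos (j + 1) hj).2
  have h2 := (tSeq_bounds h hpos j (by omega)).1
  have h3 := (h j (by omega)).shrink
  rw [← iterLog_succ] at h3
  linarith

theorem tSeq_le (h : ∀ j ≤ α, IsLarge d ρ δ σ ω kP ε (iterLog j n))
    (hpos : ∀ j ≤ α, 1 < iterLog j n) : ∀ j ≤ α, tSeq d 1 n j ≤ n := by
  intro j
  induction j with
  | zero => intro _; exact le_rfl
  | succ j ih =>
    intro hj
    have h1 := tSeq_shrink h hpos hj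
    have h2 := (tSeq_bounds h hpos (j + 1) hj).1
    have h3 := hpos (j + 1) hj
    linarith [ih (by omega)]

theorem iterLog_le_log (hpos : ∀ j ≤ α, 1 < iterLog j n) :
    ∀ j, j + 1 ≤ α → iterLog (j + 1) n ≤ Real.log n := by
  intro j
  induction j with
  | zero => intro _; exact le_rfl
  | succ j ih =>
    intro hj
    have h1 := hpos (j + 1) (by omega)
    rw [iterLog_succ]
    linarith [Real.log_le_sub_one_of_pos (x := iterLog (j + 1) n) (by linarith), ih (by omega)]

/-- Since `t` drops by a factor of at least `4`, the summands at least double, and the last one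
dominates as in a geometric series. -/
theorem sum_inv_sqrt_tSeq_le (h : ∀ j ≤ α, IsLarge d ρ δ σ ω kP ε (iterLog j n))
    (hpos : ∀ j ≤ α, 1 < iterLog j n) : ∀ j, j + 1 ≤ α →
    ∑ i ∈ Finset.range (j + 1), 1 / √(tSeq d 1 n i) ≤ 2 / √(tSeq d 1 n j) := by
  intro j
  induction j with
  | zero =>
    intro _
    simp only [zero_add, Finset.sum_range_one]
    gcongr
    norm_num
  | succ j ih =>
    intro hj
    rw [Finset.sum_range_succ]
    have h0 : 0 < tSeq d 1 n (j + 1) := by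
      linarith [(tSeq_bounds h hpos (j + 1) (by omega)).1, hpos (j + 1) (by omega)]
    have h1 : 2 * √(tSeq d 1 n (j + 1)) ≤ √(tSeq d 1 n j) := by
      have := Real.sqrt_le_sqrt (tSeq_shrink h hpos (j := j) (by omega))
      rw [Real.sqrt_mul (by norm_num), show (4 : ℝ) = 2 ^ 2 by norm_num,
        Real.sqrt_sq (by norm_num)] at this
      exact this
    have h2 : 2 / √(tSeq d 1 n j) ≤ 1 / √(tSeq d 1 n (j + 1)) := by
      have h3 := Real.sqrt_pos.2 h0
      rw [div_le_div_iff₀ (by linarith) h3]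
      linarith
    have := ih (by omega)
    have e : 2 / √(tSeq d 1 n (j + 1)) =
        1 / √(tSeq d 1 n (j + 1)) + 1 / √(tSeq d 1 n (j + 1)) := by ring
    linarith

end

/-! ### Repeated square roots and the number of rounds -/

theorem sSeq_eq {t : ℝ} (ht : 0 < t) : ∀ i, sSeq t i = Real.exp (Real.log t / 2 ^ i)
  | 0 => by simp [sSeq, Real.exp_log ht]
  | i + 1 => by
      rw [sSeq, sSeq_eq ht i, ← Real.exp_half, pow_succ]
      ring_nf

theorem one_le_sSeq {t : ℝ} (ht : 1 ≤ t) (i : ℕ) : 1 ≤ sSeq t i := by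
  rw [sSeq_eq (by linarith)]
  exact Real.one_le_exp (div_nonneg (Real.log_nonneg ht) (by positivity))

theorem sSeq_succ_sq {t : ℝ} (ht : 1 ≤ t) (i : ℕ) : sSeq t (i + 1) ^ 2 = sSeq t i :=
  Real.sq_sqrt (by linarith [one_le_sSeq ht i])

/-- The number of rounds of the uniform center algorithm brings `s` down to a constant. -/
theorem rounds_bounds {t : ℝ} (hlog : 1 < Real.log t) {τ : ℕ}
    (hτ : τ = ⌈1 / Real.log 2 * Real.log (Real.log t)⌉₊) :
    0 < τ ∧ (2 : ℝ) ^ τ ≤ 2 * Real.log t ∧ Real.log t ≤ 2 ^ τ ∧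
      (τ : ℝ) ≤ 2 * Real.log (Real.log t) + 1 := by
  have hl2 := Real.log_two_gt_d9
  have hll : 0 < Real.log (Real.log t) := Real.log_pos hlog
  have h0 : 0 < 1 / Real.log 2 * Real.log (Real.log t) := by positivity
  have h1 := Nat.le_ceil (1 / Real.log 2 * Real.log (Real.log t))
  have h2 := Nat.ceil_lt_add_one h0.le
  rw [← hτ] at h1 h2
  have h3 : (2 : ℝ) ^ τ = Real.exp (τ * Real.log 2) := by
    rw [Real.exp_nat_mul, Real.exp_log (by norm_num)]
  rw [div_mul_eq_mul_div, one_mul] at h1 h2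
  have h4 : Real.log (Real.log t) ≤ τ * Real.log 2 := by
    rwa [div_le_iff₀ (by linarith)] at h1
  have h5 : τ * Real.log 2 ≤ Real.log (Real.log t) + Real.log 2 := by
    have : (τ - 1 : ℝ) ≤ Real.log (Real.log t) / Real.log 2 := by linarith
    rw [le_div_iff₀ (by linarith)] at this
    linarith
  refine ⟨?_, ?_, ?_, ?_⟩
  · rw [hτ]
    exact Nat.ceil_pos.2 h0
  · rw [h3]
    refine (Real.exp_le_exp.2 h5).trans (le_of_eq ?_)
    rw [Real.exp_add, Real.exp_log (by linarith), Real.exp_log (by norm_num), mul_comm]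
  · rw [h3]
    calc Real.log t = Real.exp (Real.log (Real.log t)) := (Real.exp_log (by linarith)).symm
      _ ≤ _ := Real.exp_le_exp.2 h4
  · have : Real.log (Real.log t) / Real.log 2 ≤ 2 * Real.log (Real.log t) := by
      rw [div_le_iff₀ (by linarith)]
      nlinarith
    linarith

section

variable {d : ℕ}

/-! ### Classes of points -/

theorem dist_le_of_radius_le {C : Finset (Pt d)} {r : ℝ} (h : radius C ≤ r) {x y : Pt d}
    (hx : x ∈ C) (hy : y ∈ C) : dist x y ≤ 2 * r := by
  have : Nonempty C := ⟨⟨x, hx⟩⟩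
  obtain ⟨z, hz⟩ := exists_eq_ciInf_of_finite (f := fun x : C => ⨆ y : C, dist x.1 y.1)
  have h1 : ∀ y : C, dist z.1 y.1 ≤ r := fun y =>
    (le_ciSup (Set.finite_range fun y : C => dist z.1 y.1).bddAbove y).trans
      ((le_of_eq hz).trans h)
  have h2 := h1 ⟨x, hx⟩
  have h3 := h1 ⟨y, hy⟩
  have h4 := dist_triangle_left x y z.1
  simp only at h2 h3
  linarith

theorem dist_le_of_mem_part {P : Finset (Pt d)} {𝒞 : Clustering P} {r : ℝ} (h : 𝒞.cost ≤ r)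
    {C : Finset (Pt d)} (hC : C ∈ 𝒞.parts) {x y : Pt d} (hx : x ∈ C) (hy : y ∈ C) :
    dist x y ≤ 2 * r := by
  refine dist_le_of_radius_le (le_trans ?_ h) hx hy
  exact le_ciSup (f := fun C : 𝒞.parts => radius C.1)
    (Set.finite_range fun C : 𝒞.parts => radius C.1).bddAbove ⟨C, hC⟩

/-- The cell of a point in the grid of the given mesh. -/
def gridCell (m : ℝ) (x : Pt d) : Fin d → ℤ := fun i => ⌊x i / m⌋

theorem abs_coord_sub_le (x y : Pt d) (i : Fin d) : |x i - y i| ≤ dist x y := by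
  rw [← Real.dist_eq]
  have := PiLp.dist_apply_le (p := 2) x y i
  exact this

theorem dist_le_of_gridCell_eq {m : ℝ} (hm : 0 < m) {x y : Pt d}
    (h : gridCell m x = gridCell m y) : dist x y ≤ d * m := by
  have h1 : ∀ i, |x i - y i| ≤ m := by
    intro i
    have h2 := Int.abs_sub_lt_one_of_floor_eq_floor (congrFun h i)
    rw [← sub_div, abs_div, abs_of_pos hm, div_lt_one hm] at h2
    exact h2.le
  have h3 : dist x y ^ 2 ≤ (d * m) ^ 2 := by
    rw [← sum_sq_sub]
    calc ∑ i, (x i - y i) ^ 2 ≤ ∑ _i : Fin d, m ^ 2 := by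
          refine Finset.sum_le_sum fun i _ => ?_
          rw [← sq_abs]
          exact pow_le_pow_left₀ (abs_nonneg _) (h1 i) 2
      _ = d * m ^ 2 := by simp
      _ ≤ (d * m) ^ 2 := by
          rw [mul_pow]
          gcongr
          exact_mod_cast Nat.le_self_pow two_ne_zero d
  exact le_of_sq_le_sq h3 (by positivity)

theorem card_gridCell_le {m D : ℝ} (hm : 0 < m) (C : Finset (Pt d))
    (hC : ∀ x ∈ C, ∀ y ∈ C, dist x y ≤ D * m) :
    (C.image (gridCell m)).card ≤ (2 * ⌈D⌉₊ + 1) ^ d := by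
  rcases C.eq_empty_or_nonempty with rfl | ⟨y, hy⟩
  · simp
  have hsub : C.image (gridCell m) ⊆ Fintype.piFinset fun i =>
      Finset.Icc (gridCell m y i - ⌈D⌉₊) (gridCell m y i + ⌈D⌉₊) := by
    intro f hf
    obtain ⟨x, hx, rfl⟩ := Finset.mem_image.1 hf
    rw [Fintype.mem_piFinset]
    intro i
    rw [Finset.mem_Icc]
    have h1 : |x i / m - y i / m| ≤ ⌈D⌉₊ := by
      rw [← sub_div, abs_div, abs_of_pos hm, div_le_iff₀ hm]
      refine (abs_coord_sub_le x y i).trans ((hC x hx y hy).trans ?_)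
      gcongr
      exact Nat.le_ceil D
    rw [abs_le] at h1
    unfold gridCell
    constructor
    · rw [Int.le_floor]
      push_cast
      linarith [Int.floor_le (y i / m)]
    · have : ((⌊x i / m⌋ : ℤ) : ℝ) < ((⌊y i / m⌋ + ⌈D⌉₊ + 1 : ℤ) : ℝ) := by
        push_cast
        linarith [Int.floor_le (x i / m), Int.lt_floor_add_one (y i / m)]
      have := Int.cast_lt.1 this
      omega
  refine (Finset.card_le_card hsub).trans ?_
  rw [Fintype.card_piFinset]
  refine le_of_eq ?_
  calc _ = ∏ _i : Fin d, (2 * ⌈D⌉₊ + 1) := by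
        refine Finset.prod_congr rfl fun i _ => ?_
        rw [Int.card_Icc]
        omega
    _ = _ := by simp

/-- The clusters of cost `r`, refined by a grid such that points of one class have distance at
most `2 r / X`. -/
def refinedKey {P : Finset (Pt d)} (𝒞 : Clustering P) (r X : ℝ) (x : Pt d) :
    Finset (Pt d) × (Fin d → ℤ) :=
  -- A cell of mesh `m` has diameter at most `d * m`; dividing by `d + 1` absorbs this factor and
  -- also covers `d = 0`.
  (𝒞.part x, gridCell (2 * r / X / (d + 1)) x)

theorem dist_le_of_refinedKey_eq {P : Finset (Pt d)} {𝒞 : Clustering P} {r X : ℝ} (hr : 0 < r)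
    (hX : 0 < X) {x y : Pt d} (h : refinedKey 𝒞 r X x = refinedKey 𝒞 r X y) :
    dist x y ≤ 2 * (r / X) := by
  have h1 := dist_le_of_gridCell_eq (by positivity) (congrArg Prod.snd h)
  refine h1.trans ?_
  rw [mul_div_assoc', div_le_iff₀ (by positivity)]
  have : 0 < 2 * r / X := by positivity
  have e : 2 * (r / X) = 2 * r / X := by ring
  rw [e]
  nlinarith

/-- A cluster of diameter `2 * r` spans `(d + 1) * X` meshes per coordinate, and `2 * ⌈(d + 1) * X⌉
+ 1 ≤ (2 * d + 5) * X` as `1 ≤ X`. -/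
theorem card_refinedKey_le {P : Finset (Pt d)} {𝒞 : Clustering P} {r X : ℝ} (hr : 0 < r)
    (hX : 1 ≤ X) (h : 𝒞.cost ≤ r) :
    ((P.image (refinedKey 𝒞 r X)).card : ℝ) ≤ 𝒞.parts.card * ((2 * d + 5) ^ d * X ^ d) := by
  have hX0 : 0 < X := by linarith
  set m := 2 * r / X / (d + 1) with hm
  have hm0 : 0 < m := by positivity
  have hsub : P.image (refinedKey 𝒞 r X) ⊆
      𝒞.parts.biUnion fun C => (C.image (gridCell m)).image fun f => (C, f) := by
    intro k hk
    obtain ⟨x, hx, rfl⟩ := Finset.mem_image.1 hk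
    rw [Finset.mem_biUnion]
    exact ⟨𝒞.part x, 𝒞.part_mem.2 hx, Finset.mem_image.2 ⟨_, Finset.mem_image_of_mem _
      (𝒞.mem_part hx), rfl⟩⟩
  have hcell : ∀ C ∈ 𝒞.parts, ((C.image (gridCell m)).image fun f => (C, f)).card ≤
      (2 * ⌈(d + 1) * X⌉₊ + 1) ^ d := by
    intro C hC
    refine Finset.card_image_le.trans (card_gridCell_le hm0 C fun x hx y hy => ?_)
    refine (dist_le_of_mem_part h hC hx hy).trans (le_of_eq ?_)
    rw [hm]
    field_simp
  have h1 := (Finset.card_le_card hsub).trans (Finset.card_biUnion_le_card_mul _ _ _ hcell)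
  have h2 : ((P.image (refinedKey 𝒞 r X)).card : ℝ) ≤
      𝒞.parts.card * (2 * (⌈(d + 1) * X⌉₊ : ℝ) + 1) ^ d := by exact_mod_cast h1
  refine h2.trans ?_
  rw [← mul_pow]
  gcongr
  have := (Nat.ceil_lt_add_one (a := (d + 1) * X) (by positivity)).le
  nlinarith

/-! ### Uniform-Center -/

section

variable {e : Env d} {ι : Type*} {key : Pt d → ι}

/-- With `p = 1 / s` and at most `a * (N + u) * s ^ 2` points, one round leaves `(2 * a + 1) * (N +
u) * s`; the coefficients `2 ^ (i + 1) - 1` solve this recursion. The sequence `low` records sizes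
from below, so that enough hubs are sampled while the points exceed the local space. -/
theorem uniformCenter_fails_le (hl : IsListing e.lst) (hc : 1 < e.c) {r : ℝ} (hr : 0 < r)
    {V : Finset (Pt d)} (I : Finset ι) (hI : ∀ x ∈ V, key x ∈ I)
    (hkey : ∀ x ∈ V, ∀ y ∈ V, key x = key y → dist x y ≤ 2 * r) {η : ℝ} (hη : 0 ≤ η)
    (hsearch : ∀ Q ⊆ V, ∀ H ⊆ Q, H.Nonempty →
      fails (nearestHubSearch e Q H) (IsNearAssignment e Q H) ≤ ENNReal.ofReal η)
    {t u v N : ℝ} (ht : 1 ≤ t) (hu : 0 ≤ u) (hN : I.card ≤ N) (hv : 0 < v)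
    (hV : V.card ≤ (N + u) * t) (low : ℕ → ℝ) (hlow0 : low 0 ≤ V.card)
    (hlow : ∀ i, low (i + 1) ≤ pSeq e t i * low i / 4) (hp0 : 0 < e.p₀) (hp1 : e.p₀ ≤ 1)
    (hbig : ∀ i, 4 * v ≤ pSeq e t i * e.S ∨ 4 * v ≤ pSeq e t i * low i) (i : ℕ) :
    fails (uniformCenter e V r t i) (fun T => T ⊆ V ∧ (T.card ≤ e.S ∨ low i ≤ T.card) ∧
      T.card ≤ (2 ^ (i + 1) - 1) * (N + u) * sSeq t (i - 1)) ≤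
      ENNReal.ofReal (i * (Real.exp (-v) + Real.exp (-u) + η)) := by
  have hB : 0 ≤ N + u := add_nonneg ((Nat.cast_nonneg _).trans hN) hu
  have hp : ∀ i, 0 < pSeq e t i ∧ pSeq e t i ≤ 1 := by
    rintro (_ | i)
    · exact ⟨hp0, hp1⟩
    · have := one_le_sSeq ht (i + 1)
      simp only [pSeq]
      exact ⟨by positivity, by rwa [div_le_one (by linarith)]⟩
  induction i with
  | zero =>
    refine fails_pure_some ⟨subset_rfl, Or.inr hlow0, ?_⟩
    -- The index `0 - 1` truncates to `0`, so the bound starts from `s_0 = t`.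
    change (V.card : ℝ) ≤ (2 ^ (0 + 1) - 1) * (N + u) * t
    norm_num
    linarith
  | succ i ih =>
    have hstep : ENNReal.ofReal (((i + 1 : ℕ) : ℝ) * (Real.exp (-v) + Real.exp (-u) + η)) =
        ENNReal.ofReal (i * (Real.exp (-v) + Real.exp (-u) + η)) +
          ENNReal.ofReal (Real.exp (-v) + Real.exp (-u) + η) := by
      rw [← ENNReal.ofReal_add (by positivity) (by positivity)]
      congr 1
      push_cast
      ring
    rw [hstep]
    refine fails_andThen ih ?_
    rintro Q ⟨hQV, hQl, hQu⟩
    obtain ⟨hpi0, hpi1⟩ := hp i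
    refine (fails_mono ?_).trans (sampleAndSolve_uniform hl hc hr I (fun x hx => hI x (hQV hx))
      (fun x hx y hy => hkey x (hQV hx) y (hQV hy)) hη (fun H hH => hsearch Q hQV H hH)
      hpi0 hpi1 hu hN hv ?_)
    · rintro T ⟨hT1, hT2, hT3⟩
      have hTQ : (T.card : ℝ) ≤ Q.card := by exact_mod_cast Finset.card_le_card hT1
      refine ⟨hT1.trans hQV, ?_, ?_⟩
      · rcases hQl with hQl | hQl
        · exact Or.inl ((Finset.card_le_card hT1).trans hQl)
        · refine hT2.imp_right fun h => (hlow i).trans (le_trans ?_ h)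
          gcongr
      -- The round with `p₀` is credited with no reduction: its output is a subset of its input, and
      -- the new coefficient is larger.
      · rcases i with _ | i
        · simp only [Nat.zero_sub, Nat.add_sub_cancel, sSeq] at hQu ⊢
          have : 0 ≤ (N + u) * t := mul_nonneg hB (by linarith)
          norm_num at hQu ⊢
          linarith
        · simp only [Nat.add_sub_cancel] at hQu ⊢
          simp only [pSeq] at hT3
          have hs := one_le_sSeq ht (i + 1)
          rw [← sSeq_succ_sq ht i] at hQu
          set s := sSeq t (i + 1)
          have h1 : 2 * (1 / s) * (Q.card : ℝ) ≤
              2 * (1 / s) * ((2 ^ (i + 1 + 1) - 1) * (N + u) * s ^ 2) := by gcongr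
          have h2 : 2 * (1 / s) * ((2 ^ (i + 1 + 1) - 1) * (N + u) * s ^ 2) +
              (N + u) / (1 / s) = (2 ^ (i + 1 + 1 + 1) - 1) * (N + u) * s := by
            field_simp
            ring
          linarith
    · intro hS
      rcases hbig i with h | h
      · have : pSeq e t i * e.S ≤ pSeq e t i * Q.card := by gcongr
        linarith
      · rcases hQl with hQl | hQl
        · omega
        · have : pSeq e t i * low i ≤ pSeq e t i * Q.card := by gcongr
          linarith

/-! ### The second phase -/

theorem card_le_add_excess (I : Finset ι) {Q : Finset (Pt d)} (hQ : ∀ x ∈ Q, key x ∈ I) :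
    Q.card ≤ I.card + excess key I Q := by
  rw [← sum_card_classes key I Q hQ, Finset.card_eq_sum_ones, excess, ← Finset.sum_add_distrib]
  exact Finset.sum_le_sum fun k _ => by omega

theorem excess_le_card (I : Finset ι) {Q : Finset (Pt d)} (hQ : ∀ x ∈ Q, key x ∈ I) :
    excess key I Q ≤ Q.card := by
  rw [← sum_card_classes key I Q hQ, excess]
  exact Finset.sum_le_sum fun k _ => Nat.sub_le _ _

/-- The term `6 * u` is the fixed point of `x ↦ 2 / 3 * x + 2 * u`; what lies above it contracts
geometrically. -/
theorem phase2_fails_le (hl : IsListing e.lst) (hc : 1 < e.c) {r : ℝ} (hr : 0 < r) (K : Consts)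
    (α : ℕ) {P : Finset (Pt d)} (I : Finset ι) (hI : ∀ x ∈ P, key x ∈ I)
    (hkey : ∀ x ∈ P, ∀ y ∈ P, key x = key y → dist x y ≤ 2 * r) {η : ℝ} (hη : 0 ≤ η)
    (hsearch : ∀ Q ⊆ P, ∀ H ⊆ Q, H.Nonempty →
      fails (nearestHubSearch e Q H) (IsNearAssignment e Q H) ≤ ENNReal.ofReal η)
    {u v E F : ℝ} (hu : 0 ≤ u) (hv : 0 < v) (hS : 8 * v ≤ e.S) (hF : 0 ≤ F)
    (hphase : fails (phase1 e K P r α) (fun T => T ⊆ P ∧ T.card ≤ E) ≤ ENNReal.ofReal F)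
    (i : ℕ) :
    fails (phase2 e K P r α i) (fun T => T ⊆ P ∧
      (excess key I T : ℝ) ≤ (2 / 3) ^ i * E + 6 * u) ≤
      ENNReal.ofReal (F + i * (Real.exp (-v) + Real.exp (-u) + η)) := by
  induction i with
  | zero =>
    refine (fails_mono ?_).trans (hphase.trans (le_of_eq (by simp)))
    rintro T ⟨hT, hE⟩
    refine ⟨hT, ?_⟩
    have : (excess key I T : ℝ) ≤ T.card := by
      exact_mod_cast excess_le_card I fun x hx => hI x (hT hx)
    simp only [pow_zero, one_mul]
    linarith
  | succ i ih =>
    have hstep : ENNReal.ofReal (F + ((i + 1 : ℕ) : ℝ) * (Real.exp (-v) + Real.exp (-u) + η)) =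
        ENNReal.ofReal (F + i * (Real.exp (-v) + Real.exp (-u) + η)) +
          ENNReal.ofReal (Real.exp (-v) + Real.exp (-u) + η) := by
      rw [← ENNReal.ofReal_add (by positivity) (by positivity)]
      congr 1
      push_cast
      ring
    rw [hstep]
    refine fails_andThen ih ?_
    rintro Q ⟨hQP, hQ⟩
    refine (fails_mono ?_).trans (sampleAndSolve_half hl hc hr I (fun x hx => hI x (hQP hx))
      (fun x hx y hy => hkey x (hQP hx) y (hQP hy)) hη (fun H hH => hsearch Q hQP H hH)
      hu hv ?_)
    · rintro T ⟨hT, hTe⟩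
      refine ⟨hT.trans hQP, ?_⟩
      rw [pow_succ]
      linarith
    · intro hSQ
      have : (e.S : ℝ) ≤ Q.card := by exact_mod_cast hSQ.le
      linarith

end

end

section

variable {d : ℕ} {K : Consts} {ρ δ σ ω ε c : ℝ} {ℋ : ℕ → ℝ → PMF (Pt d → ℕ)}
  {lst : Finset (Pt d) → List (Pt d)} {P : Finset (Pt d)}

/-! ### The parameters of the algorithm -/

/-- With `n` the number of points of `P`, at most `n` far hubs, each colliding with probability `n ^
(-2)`, consume at most half of `n ^ (-ρ / 2)`. Then `n ^ ρ` hash functions all fail with probability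
at most `exp (-n ^ (ρ / 2) / 2)`, which outweighs the union over points and repetitions. -/
theorem mkEnv_search (hl : IsListing lst) (hc : 1 < c) (hρ0 : 0 < ρ) (hρ1 : ρ < 1)
    (hI : K.kI = 1) (hL : K.kL = 1) (hlarge : IsLarge d ρ δ σ ω K.kP ε P.card)
    (hℋ : ∀ n : ℕ, 2 ≤ n → ∀ s : ℝ, 0 < s →
      IsLSH (ℋ n s) s (c * s) ((1 / (n : ℝ)) ^ (ρ / 2)) ((1 / (n : ℝ)) ^ 2))
    (hsep : ∀ x ∈ P, ∀ y ∈ P, x ≠ y → 1 ≤ dist x y) {Q H : Finset (Pt d)} (hQ : Q ⊆ P)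
    (hHQ : H ⊆ Q) (hH : H.Nonempty) :
    fails (nearestHubSearch (mkEnv K ρ δ σ c ℋ lst P) Q H)
      (IsNearAssignment (mkEnv K ρ δ σ c ℋ lst P) Q H) ≤ ENNReal.ofReal (1 / P.card) := by
  have hn1 : (1 : ℝ) < P.card := hlarge.pos (Nat.cast_nonneg _)
  have hlog := hlarge.two_le_log
  have hn0 : (0 : ℝ) < P.card := by linarith
  have hn4 : (4 : ℝ) ≤ P.card := by
    have h1 := Real.exp_log hn0
    have h2 := Real.exp_le_exp.2 hlog
    have h3 : Real.exp 2 = Real.exp 1 * Real.exp 1 := by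
      rw [← Real.exp_add]
      norm_num
    nlinarith [Real.exp_one_gt_d9]
  have hn2 : 2 ≤ P.card := by
    have : (2 : ℝ) ≤ P.card := by linarith
    exact_mod_cast this
  have hreps : 0 < (mkEnv K ρ δ σ c ℋ lst P).reps := by
    simp only [mkEnv, hI, one_mul]
    exact Nat.ceil_pos.2 (by linarith)
  refine (nearestHubSearch_fails_le (e := mkEnv K ρ δ σ c ℋ lst P) hl (zero_lt_one.trans hc) hreps
    (by positivity) (hℋ P.card hn2) hHQ hH (fun x hx y hy => hsep x (hQ hx) y (hQ hy)) ?_).trans ?_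
  · intro x hx y hy
    exact Metric.dist_le_diam_of_mem P.finite_toSet.isBounded (hQ hx) (hQ hy)
  refine ENNReal.ofReal_le_ofReal (le_trans ?_ hlarge.search)
  set n : ℝ := (P.card : ℝ)
  have hHn : (H.card : ℝ) ≤ n := Nat.cast_le.2 (Finset.card_le_card (hHQ.trans hQ))
  have hQn : (Q.card : ℝ) ≤ n := Nat.cast_le.2 (Finset.card_le_card hQ)
  have hrp : ∀ a : ℝ, (1 / n) ^ a = n ^ (-a) := by
    intro a
    rw [one_div, Real.inv_rpow hn0.le, Real.rpow_neg hn0.le]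
  have hp₁ : (1 / n) ^ (ρ / 2) ≤ 1 :=
    Real.rpow_le_one (by positivity) (by rw [div_le_one hn0]; linarith) (by linarith)
  have hp₂ : (H.card : ℝ) * (1 / n) ^ 2 ≤ (1 / n) ^ (ρ / 2) / 2 := by
    have h1 : (H.card : ℝ) * (1 / n) ^ 2 ≤ 1 / n := by
      calc (H.card : ℝ) * (1 / n) ^ 2 ≤ n * (1 / n) ^ 2 := by gcongr
        _ = 1 / n := by field_simp
    refine h1.trans ?_
    have h2 : n ^ (-(1 / 2) : ℝ) ≤ (1 / n) ^ (ρ / 2) := by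
      rw [hrp]
      exact Real.rpow_le_rpow_of_exponent_le hn1.le (by linarith)
    have h3 : 1 / n = n ^ (-(1 / 2) : ℝ) * n ^ (-(1 / 2) : ℝ) := by
      rw [← Real.rpow_add hn0]
      norm_num
      rw [Real.rpow_neg_one]
    have h4 : n ^ (-(1 / 2) : ℝ) ≤ 1 / 2 := by
      calc n ^ (-(1 / 2) : ℝ) ≤ 4 ^ (-(1 / 2) : ℝ) :=
            Real.rpow_le_rpow_of_nonpos (by norm_num) hn4 (by norm_num)
        _ = 1 / 2 := by
            rw [show (4 : ℝ) = 2 ^ (2 : ℝ) by norm_num, ← Real.rpow_mul (by norm_num)]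
            norm_num
    have h5 : 0 < n ^ (-(1 / 2) : ℝ) := by positivity
    refine h3.le.trans ?_
    nlinarith
  have hp₂0 : 0 ≤ (H.card : ℝ) * (1 / n) ^ 2 := by positivity
  have hbase0 : 0 ≤ 1 - ((1 / n) ^ (ρ / 2) - H.card * (1 / n) ^ 2) := by linarith
  have hbase : 1 - ((1 / n) ^ (ρ / 2) - H.card * (1 / n) ^ 2) ≤
      Real.exp (-((1 / n) ^ (ρ / 2) / 2)) := by
    linarith [Real.one_sub_le_exp_neg ((1 / n) ^ (ρ / 2) / 2)]
  have hhash : n ^ ρ ≤ ((mkEnv K ρ δ σ c ℋ lst P).hashes : ℝ) := by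
    simp only [mkEnv, hL, one_mul]
    exact Nat.le_ceil _
  have hreps' : ((mkEnv K ρ δ σ c ℋ lst P).reps : ℝ) ≤ Real.log n + 1 := by
    simp only [mkEnv, hI, one_mul]
    exact (Nat.ceil_lt_add_one (by linarith)).le
  gcongr
  calc _ ≤ Real.exp (-((1 / n) ^ (ρ / 2) / 2)) ^ (mkEnv K ρ δ σ c ℋ lst P).hashes :=
        pow_le_pow_left₀ hbase0 hbase _
    _ = Real.exp ((mkEnv K ρ δ σ c ℋ lst P).hashes * -((1 / n) ^ (ρ / 2) / 2)) :=
        (Real.exp_nat_mul _ _).symm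
    _ ≤ Real.exp (-(n ^ (ρ / 2) / 2)) := by
        rw [Real.exp_le_exp]
        have h1 : n ^ ρ * (1 / n) ^ (ρ / 2) = n ^ (ρ / 2) := by
          rw [hrp, ← Real.rpow_add hn0]
          congr 1
          ring
        have h2 : 0 < (1 / n) ^ (ρ / 2) := by positivity
        nlinarith

/-! ### Size control and analysis of the first phase -/

/-- Lower bounds on the numbers of points in the rounds of the first subphase. -/
def sizeLower (n kP δ : ℝ) : ℕ → ℝ
  | 0 => n
  | i + 1 => kP * Real.log n / n ^ δ * sSeq n i / 4 ^ (i + 1)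

/-- Unless the remaining points fit into the local space, each round of the first subphase
samples many hubs. -/
theorem first_subphase_large {k₀ : ℕ} (hlarge : IsLarge d ρ δ σ ω K.kP (δ - (1 / 2) ^ k₀) P.card)
    (hδ1 : δ < 1) (hk₀ : ∀ i < k₀, δ ≤ (1 / 2) ^ i) (hkP : 4 * 4 ^ k₀ ≤ K.kP) (i : ℕ) :
    4 * Real.log P.card ≤ pSeq (mkEnv K ρ δ σ c ℋ lst P) P.card i *
        (mkEnv K ρ δ σ c ℋ lst P).S ∨
      4 * Real.log P.card ≤ pSeq (mkEnv K ρ δ σ c ℋ lst P) P.card i *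
        sizeLower P.card K.kP δ i := by
  have hn1 : (1 : ℝ) < P.card := hlarge.pos (Nat.cast_nonneg _)
  have hlog := hlarge.two_le_log
  have hgap := hlarge.space_gap
  have hS : σ * (P.card : ℝ) ^ δ ≤ (mkEnv K ρ δ σ c ℋ lst P).S := Nat.le_ceil _
  have hp0 : (mkEnv K ρ δ σ c ℋ lst P).p₀ = K.kP * Real.log P.card / (P.card : ℝ) ^ δ := rfl
  set e := mkEnv K ρ δ σ c ℋ lst P
  set n : ℝ := (P.card : ℝ)
  have hn0 : 0 < n := by linarith
  have hs : ∀ i, sSeq n i = n ^ ((1 / 2 : ℝ) ^ i) := by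
    intro i
    rw [sSeq_eq hn0, Real.rpow_def_of_pos hn0, one_div, inv_pow, div_eq_mul_inv]
  rcases i with _ | i
  · right
    simp only [pSeq, sizeLower, hp0]
    have h1 : n ^ δ ≤ n := by
      conv_rhs => rw [← Real.rpow_one n]
      exact Real.rpow_le_rpow_of_exponent_le hn1.le hδ1.le
    rw [div_mul_eq_mul_div, le_div_iff₀ (by positivity)]
    have h2 : (1 : ℝ) ≤ 4 ^ k₀ := one_le_pow₀ (by norm_num)
    have h3 : 4 * Real.log n ≤ K.kP * Real.log n := by nlinarith
    exact mul_le_mul h3 h1 (by positivity) (mul_nonneg K.kP_pos.le (by linarith))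
  · have hs1 := one_le_sSeq hn1.le (i + 1)
    -- Before round `k₀`, `s` is at least `n ^ δ` and the tracked size supplies the hubs; the factor
    -- `4 ^ k₀` in `kP` pays for the accumulated losses. From then on, `p` times the local space is
    -- at least `σ * n ^ (δ - (1 / 2) ^ k₀)`.
    by_cases hi : i + 1 < k₀
    · right
      simp only [pSeq, sizeLower]
      have h1 : n ^ δ ≤ sSeq n (i + 1) := by
        rw [hs]
        exact Real.rpow_le_rpow_of_exponent_le hn1.le (hk₀ _ hi)
      have h2 : (4 : ℝ) ^ (i + 1) ≤ 4 ^ k₀ := pow_le_pow_right₀ (by norm_num) hi.le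
      rw [← sSeq_succ_sq hn1.le i]
      have e1 : 1 / sSeq n (i + 1) * (K.kP * Real.log n / n ^ δ * sSeq n (i + 1) ^ 2 /
          4 ^ (i + 1)) = (K.kP / 4 ^ (i + 1)) * Real.log n * (sSeq n (i + 1) / n ^ δ) := by
        field_simp
      rw [e1]
      have h3 : 4 ≤ K.kP / 4 ^ (i + 1) := by
        rw [le_div_iff₀ (by positivity)]
        linarith
      have h4 : 1 ≤ sSeq n (i + 1) / n ^ δ := by
        rwa [one_le_div (by positivity)]
      have h5 : 4 * Real.log n ≤ K.kP / 4 ^ (i + 1) * Real.log n := by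
        gcongr
      nlinarith
    · left
      simp only [pSeq]
      have h1 : sSeq n (i + 1) ≤ n ^ ((1 / 2 : ℝ) ^ k₀) := by
        rw [hs]
        exact Real.rpow_le_rpow_of_exponent_le hn1.le
          (pow_le_pow_of_le_one (by norm_num) (by norm_num) (not_lt.1 hi))
      rw [Real.rpow_sub hn0] at hgap
      rw [one_div, inv_mul_eq_div, le_div_iff₀ (by linarith)]
      have h2 : 0 < n ^ ((1 / 2 : ℝ) ^ k₀) := by positivity
      rw [← mul_div_assoc, le_div_iff₀ h2] at hgap
      refine le_trans ?_ (hgap.trans hS)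
      gcongr

set_option maxHeartbeats 800000 in
/-- One subphase of the first phase. -/
theorem subphase_fails_le {k₀ α j : ℕ} {r : ℝ} {𝒞 : Clustering P} (hl : IsListing lst) (hc : 1 < c)
    (hδ1 : δ < 1) (hσ : 0 < σ) (hω : 0 < ω) (hr : 0 < r)
    (hτ : K.kτ = 1 / Real.log 2)
    (hk₀ : ∀ i < k₀, δ ≤ (1 / 2) ^ i) (hkP : 4 * 4 ^ k₀ ≤ K.kP) (hkPσ : 4 ≤ σ * K.kP)
    (hlarge : ∀ j ≤ α, IsLarge d ρ δ σ ω K.kP (δ - (1 / 2) ^ k₀) (iterLog j P.card))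
    (hpos : ∀ j ≤ α, 1 < iterLog j P.card)
    (hsearch : ∀ Q ⊆ P, ∀ H ⊆ Q, H.Nonempty →
      fails (nearestHubSearch (mkEnv K ρ δ σ c ℋ lst P) Q H)
        (IsNearAssignment (mkEnv K ρ δ σ c ℋ lst P) Q H) ≤ ENNReal.ofReal (1 / P.card))
    (hcost : 𝒞.cost ≤ r) (hω𝒞 : ω * Real.log P.card ≤ 𝒞.parts.card) (hj : j + 1 ≤ α)
    {V : Finset (Pt d)} (hVP : V ⊆ P) (hV0 : j = 0 → V = P)
    (hV : V.card ≤ tSeq d 1 P.card j * 𝒞.parts.card) :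
    fails (uniformCenter (mkEnv K ρ δ σ c ℋ lst P) V
      (r / Real.log (Real.log (tSeq d 1 P.card j))) (tSeq d 1 P.card j)
      ⌈K.kτ * Real.log (Real.log (tSeq d 1 P.card j))⌉₊)
      (fun T => T ⊆ P ∧ T.card ≤ tSeq d 1 P.card (j + 1) * 𝒞.parts.card) ≤
      ENNReal.ofReal (1 / √(tSeq d 1 P.card j)) := by
  have hln := hlarge 0 (Nat.zero_le _)
  rw [iterLog_zero] at hln
  have hn1 : (1 : ℝ) < P.card := hln.pos (Nat.cast_nonneg _)
  obtain ⟨htl, htu⟩ := tSeq_bounds hlarge hpos j (by omega)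
  have htn := tSeq_le hlarge hpos j (by omega)
  have hlj := hlarge j (by omega)
  have hpj := hpos j (by omega)
  have hlj1 := hlarge (j + 1) hj
  have hpj1 := hpos (j + 1) hj
  have htrec : tSeq d 1 P.card (j + 1) = Real.log (tSeq d 1 P.card j) *
      Real.log (Real.log (tSeq d 1 P.card j)) ^ (d + 2) := by
    simp only [tSeq, one_mul]
  have ht0 : j = 0 → tSeq d 1 P.card j = P.card := by
    rintro rfl
    rfl
  have htl1 : iterLog (j + 1) P.card ≤ Real.log (tSeq d 1 P.card j) := by
    rw [iterLog_succ]
    exact Real.log_le_log (by linarith) htl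
  have hsmall : 0 < j → iterLog j P.card ≤ Real.log P.card := by
    intro h0
    obtain ⟨i, rfl⟩ : ∃ i, j = i + 1 := ⟨j - 1, by omega⟩
    exact iterLog_le_log hpos i (by omega)
  rw [htrec]
  set t := tSeq d 1 P.card j
  have ht1 : 1 < t := by linarith
  have hlogt : 1 < Real.log t := by linarith
  have hlogtn : Real.log t ≤ Real.log P.card := Real.log_le_log (by linarith) htn
  set X := Real.log (Real.log t) with hX
  have hXl : Real.log (iterLog (j + 1) P.card) ≤ X := Real.log_le_log (by linarith) htl1
  have hX1 : 1 ≤ X := by linarith [hlj1.two_le_log]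
  set τ := ⌈K.kτ * X⌉₊ with hτdef
  rw [hτ] at hτdef
  obtain ⟨hτ0, hτ1, hτ2, hτ3⟩ := rounds_bounds hlogt hτdef
  set N : ℝ := 𝒞.parts.card * ((2 * d + 5) ^ d * X ^ d) with hN
  have hNC : (𝒞.parts.card : ℝ) ≤ N := by
    have h1 : (1 : ℝ) ≤ (2 * d + 5) ^ d := one_le_pow₀ (by linarith [Nat.cast_nonneg (α := ℝ) d])
    have h2 : 1 ≤ X ^ d := one_le_pow₀ hX1
    exact le_mul_of_one_le_right (Nat.cast_nonneg _) (one_le_mul_of_one_le_of_one_le h1 h2)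
  have hVt : (V.card : ℝ) ≤ (N + Real.log t) * t := by
    refine hV.trans ?_
    rw [mul_comm]
    gcongr
    linarith
  have hS : σ * (P.card : ℝ) ^ δ ≤ (mkEnv K ρ δ σ c ℋ lst P).S := Nat.le_ceil _
  have hp0 : (mkEnv K ρ δ σ c ℋ lst P).p₀ = K.kP * Real.log P.card / (P.card : ℝ) ^ δ := rfl
  have hlogn : 0 < Real.log P.card := by linarith [hln.two_le_log]
  have hkey : ∃ low : ℕ → ℝ, low 0 ≤ V.card ∧
      (∀ i, low (i + 1) ≤ pSeq (mkEnv K ρ δ σ c ℋ lst P) t i * low i / 4) ∧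
      ∀ i, 4 * Real.log P.card ≤ pSeq (mkEnv K ρ δ σ c ℋ lst P) t i *
          (mkEnv K ρ δ σ c ℋ lst P).S ∨
        4 * Real.log P.card ≤ pSeq (mkEnv K ρ δ σ c ℋ lst P) t i * low i := by
    -- Only the first subphase has sampling probabilities so small that exceeding the local space
    -- does not by itself yield enough hubs. Later ones have `s ≤ √t ≤ log n` after the initial
    -- round, so the trivial lower bound `0` suffices.
    rcases Nat.eq_zero_or_pos j with h0 | h0
    · rw [ht0 h0, hV0 h0]
      refine ⟨sizeLower P.card K.kP δ, le_rfl, ?_, first_subphase_large hln hδ1 hk₀ hkP⟩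
      rintro (_ | i)
      · simp only [sizeLower, pSeq, sSeq, hp0]
        refine le_of_eq ?_
        ring
      · simp only [sizeLower, pSeq]
        have hs := one_le_sSeq hn1.le (i + 1)
        rw [← sSeq_succ_sq hn1.le i]
        refine le_of_eq ?_
        field_simp
        ring
    · refine ⟨fun _ => 0, by simp, by simp, fun i => Or.inl ?_⟩
      have hnδ : 0 < (P.card : ℝ) ^ δ := by positivity
      rcases i with _ | i
      · simp only [pSeq, hp0]
        calc 4 * Real.log P.card ≤ σ * K.kP * Real.log P.card := by gcongr
          _ = K.kP * Real.log P.card / (P.card : ℝ) ^ δ * (σ * (P.card : ℝ) ^ δ) := by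
              field_simp
          _ ≤ _ := by
              have := K.kP_pos
              gcongr
      · simp only [pSeq]
        have hs1 : sSeq t (i + 1) ≤ Real.log P.card := by
          refine le_trans ?_ (hsmall h0)
          rw [sSeq_eq (by linarith)]
          calc Real.exp (Real.log t / 2 ^ (i + 1)) ≤ Real.exp (Real.log t / 2 ^ 1) := by
                gcongr
                · norm_num
                · omega
            _ ≤ Real.exp (Real.log (iterLog j P.card)) := by
                rw [Real.exp_le_exp, pow_one, div_le_iff₀ two_pos]
                have := Real.log_le_log (by linarith) htu
                rw [Real.log_pow] at this
                push_cast at this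
                linarith
            _ = _ := Real.exp_log (by linarith)
        have hs0 := one_le_sSeq ht1.le (i + 1)
        rw [one_div, inv_mul_eq_div, le_div_iff₀ (by linarith)]
        refine le_trans ?_ (hln.space.trans hS)
        gcongr
  obtain ⟨low, hlow0, hlow, hbig⟩ := hkey
  have hmain := uniformCenter_fails_le (e := mkEnv K ρ δ σ c ℋ lst P) hl hc
    (r := r / X) (by positivity) (V := V) (key := refinedKey 𝒞 r X)
    (P.image (refinedKey 𝒞 r X)) (fun x hx => Finset.mem_image_of_mem _ (hVP hx))
    (fun x _ y _ h => dist_le_of_refinedKey_eq hr (by linarith) h)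
    (η := 1 / P.card) (by positivity) (fun Q hQ => hsearch Q (hQ.trans hVP))
    (t := t) (u := Real.log t) (v := Real.log P.card) (N := N) ht1.le (by linarith)
    (card_refinedKey_le hr hX1 hcost) hlogn hVt low hlow0 hlow
    (by rw [hp0]; have := K.kP_pos; positivity) (by rw [hp0]; exact hln.prob_le) hbig τ
  refine (fails_mono ?_).trans (hmain.trans (ENNReal.ofReal_le_ofReal ?_))
  · rintro T ⟨hT1, -, hT2⟩
    refine ⟨hT1.trans hVP, hT2.trans ?_⟩
    -- The estimate for the last round involves `s` one index earlier, hence `exp 2` in place of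
    -- `exp 1`.
    have hs : sSeq t (τ - 1) ≤ Real.exp 2 := by
      rw [sSeq_eq (by linarith), Real.exp_le_exp, div_le_iff₀ (by positivity), ← pow_succ',
        Nat.sub_add_cancel hτ0]
      exact hτ2
    have hpow : (2 : ℝ) ^ (τ + 1) - 1 ≤ 4 * Real.log t := by
      rw [pow_succ]
      linarith
    -- The lower bound on the number of clusters enters here: it charges the additive deviation `u =
    -- log t` to the clusters.
    have hu : Real.log t ≤ 𝒞.parts.card * (1 / ω) := by
      rw [mul_one_div, le_div_iff₀ hω]
      nlinarith
    have hcent := hlj1.centers X hXl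
    have hNu : 0 ≤ N + Real.log t := by positivity
    calc (2 ^ (τ + 1) - 1) * (N + Real.log t) * sSeq t (τ - 1)
        ≤ 4 * Real.log t * (N + 𝒞.parts.card * (1 / ω)) * Real.exp 2 := by
          have := one_le_sSeq ht1.le (τ - 1)
          gcongr
      _ = Real.log t * 𝒞.parts.card *
          (4 * Real.exp 2 * ((2 * d + 5) ^ d * X ^ d + 1 / ω)) := by
          rw [hN]
          ring
      _ ≤ Real.log t * 𝒞.parts.card * X ^ (d + 2) := by gcongr
      _ = _ := by ring
  · rw [Real.exp_neg, Real.exp_neg, Real.exp_log (by linarith), Real.exp_log (by linarith)]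
    have h1 : (P.card : ℝ)⁻¹ ≤ t⁻¹ := inv_anti₀ (by linarith) htn
    have h2 := hlj.rounds t htl
    have h3 : 0 < √t := Real.sqrt_pos.2 (by linarith)
    have h4 : √t * √t = t := Real.mul_self_sqrt (by linarith)
    calc (τ : ℝ) * ((P.card : ℝ)⁻¹ + t⁻¹ + 1 / P.card) ≤ τ * (3 * t⁻¹) := by
          gcongr
          rw [one_div]
          linarith
      _ = 3 * τ / t := by ring
      _ ≤ √t / t := by
          gcongr
          linarith
      _ = 1 / √t := by
          rw [div_eq_div_iff (by linarith) h3.ne', h4, one_mul]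

/-- The first phase. -/
theorem phase1_fails_le {k₀ α : ℕ} {r : ℝ} {𝒞 : Clustering P} (hl : IsListing lst) (hc : 1 < c)
    (hδ1 : δ < 1) (hσ : 0 < σ) (hω : 0 < ω) (hr : 0 < r)
    (hτ : K.kτ = 1 / Real.log 2) (hT : K.kT = 1)
    (hk₀ : ∀ i < k₀, δ ≤ (1 / 2) ^ i) (hkP : 4 * 4 ^ k₀ ≤ K.kP) (hkPσ : 4 ≤ σ * K.kP)
    (hlarge : ∀ j ≤ α, IsLarge d ρ δ σ ω K.kP (δ - (1 / 2) ^ k₀) (iterLog j P.card))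
    (hpos : ∀ j ≤ α, 1 < iterLog j P.card)
    (hsearch : ∀ Q ⊆ P, ∀ H ⊆ Q, H.Nonempty →
      fails (nearestHubSearch (mkEnv K ρ δ σ c ℋ lst P) Q H)
        (IsNearAssignment (mkEnv K ρ δ σ c ℋ lst P) Q H) ≤ ENNReal.ofReal (1 / P.card))
    (hcost : 𝒞.cost ≤ r) (hω𝒞 : ω * Real.log P.card ≤ 𝒞.parts.card) :
    ∀ j ≤ α, fails (phase1 (mkEnv K ρ δ σ c ℋ lst P) K P r j)
      (fun T => (T ⊆ P ∧ T.card ≤ tSeq d 1 P.card j * 𝒞.parts.card) ∧ (j = 0 → T = P)) ≤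
      ENNReal.ofReal (∑ i ∈ Finset.range j, 1 / √(tSeq d 1 P.card i)) := by
  intro j
  induction j with
  | zero =>
    intro _
    refine fails_pure_some ⟨⟨subset_rfl, ?_⟩, fun _ => rfl⟩
    have hn1 := hpos 0 (Nat.zero_le _)
    have hlog := (hlarge 0 (Nat.zero_le _)).two_le_log
    rw [iterLog_zero] at hn1 hlog
    have h0 : (0 : ℝ) < 𝒞.parts.card := lt_of_lt_of_le (by positivity) hω𝒞
    have h1 : (1 : ℝ) ≤ 𝒞.parts.card := by exact_mod_cast Nat.cast_pos.1 h0
    simp only [tSeq]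
    nlinarith
  | succ j ih =>
    intro hj
    rw [Finset.sum_range_succ, ENNReal.ofReal_add
      (Finset.sum_nonneg fun i _ => by positivity) (by positivity)]
    refine fails_andThen (ih (by omega)) ?_
    -- The equality with `P` at index zero is carried along because the size bounds in the first
    -- subphase start from all `n` points.
    rintro V ⟨⟨hV1, hV2⟩, hV3⟩
    rw [hT]
    exact (fails_mono fun T hT => ⟨hT, fun h => absurd h (Nat.succ_ne_zero j)⟩).trans
      (subphase_fails_le hl hc hδ1 hσ hω hr hτ hk₀ hkP hkPσ hlarge hpos hsearch hcost hω𝒞 hj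
        hV1 hV3 hV2)

/-- With `L` and `ℓ` the iterated logarithms of order `α` and `α - 1`, the choice `u = L` gives
failure probability `exp (-L) = 1 / ℓ` per round of the second phase. The first phase contributes `2
/ √ℓ`, and `total` absorbs the sum into `ℓ ^ (-1 / 4)`. -/
theorem extKCenter_fails_le {k₀ α : ℕ} {r : ℝ} {𝒞 : Clustering P} (hl : IsListing lst)
    (hc : 1 < c) (hδ1 : δ < 1) (hσ : 0 < σ) (hω : 0 < ω) (hr : 0 < r)
    (hτ : K.kτ = 1 / Real.log 2) (hT : K.kT = 1) (hβ : K.kβ = 9)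
    (hk₀ : ∀ i < k₀, δ ≤ (1 / 2) ^ i) (hkP : 4 * 4 ^ k₀ ≤ K.kP) (hkPσ : 4 ≤ σ * K.kP)
    (hlarge : ∀ j ≤ α, IsLarge d ρ δ σ ω K.kP (δ - (1 / 2) ^ k₀) (iterLog j P.card))
    (hpos : ∀ j ≤ α, 1 < iterLog j P.card)
    (hsearch : ∀ Q ⊆ P, ∀ H ⊆ Q, H.Nonempty →
      fails (nearestHubSearch (mkEnv K ρ δ σ c ℋ lst P) Q H)
        (IsNearAssignment (mkEnv K ρ δ σ c ℋ lst P) Q H) ≤ ENNReal.ofReal (1 / P.card))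
    (hcost : 𝒞.cost ≤ r) (hω𝒞 : ω * Real.log P.card ≤ 𝒞.parts.card) (hα : 1 ≤ α) :
    fails (extKCenter K ρ δ σ c ℋ lst α P r) (fun T => (T.card : ℝ) ≤
        𝒞.parts.card * (1 + 1 / iterLog α P.card) + iterLog α P.card ^ 3) ≤
      ENNReal.ofReal (1 / iterLog (α - 1) P.card ^ (1 / 4 : ℝ)) := by
  obtain ⟨a, rfl⟩ : ∃ a, α = a + 1 := ⟨α - 1, by omega⟩
  have hln := hlarge 0 (Nat.zero_le _)
  rw [iterLog_zero] at hln
  have hn1 : (1 : ℝ) < P.card := hln.pos (Nat.cast_nonneg _)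
  have hlogn := hln.two_le_log
  have hphase := phase1_fails_le hl hc hδ1 hσ hω hr hτ hT hk₀ hkP hkPσ hlarge hpos hsearch hcost
    hω𝒞 (a + 1) le_rfl
  have hsum := sum_inv_sqrt_tSeq_le hlarge hpos a le_rfl
  have htu := (tSeq_bounds hlarge hpos (a + 1) le_rfl).2
  obtain ⟨htal, -⟩ := tSeq_bounds hlarge hpos a (by omega)
  have hℓn : iterLog a P.card ≤ P.card :=
    htal.trans (tSeq_le hlarge hpos a (by omega))
  have hla := hlarge a (by omega)
  have hpa := hpos a (by omega)
  have hlL := hlarge (a + 1) le_rfl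
  have hpL := hpos (a + 1) le_rfl
  have hL : iterLog (a + 1) P.card = Real.log (iterLog a P.card) := iterLog_succ _ _
  have hS : σ * (P.card : ℝ) ^ δ ≤ (mkEnv K ρ δ σ c ℋ lst P).S := Nat.le_ceil _
  unfold extKCenter
  rw [hβ, Nat.add_sub_cancel]
  have hLL : iterLog (a + 1 + 1) P.card = Real.log (iterLog (a + 1) P.card) := iterLog_succ _ _
  rw [hLL]
  set L := iterLog (a + 1) P.card
  set ℓ := iterLog a P.card
  have hlogL := hlL.two_le_log
  have hβ1 := Nat.le_ceil (9 * Real.log L)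
  have hβ2 := (Nat.ceil_lt_add_one (a := 9 * Real.log L) (by linarith)).le
  set β := ⌈9 * Real.log L⌉₊
  have hI : ∀ x ∈ P, 𝒞.part x ∈ 𝒞.parts := fun x hx => 𝒞.part_mem.2 hx
  have hmain := phase2_fails_le (e := mkEnv K ρ δ σ c ℋ lst P) hl hc hr K (a + 1)
    (key := 𝒞.part) 𝒞.parts hI
    (fun x hx y hy hxy => dist_le_of_mem_part hcost (hI x hx) (𝒞.mem_part hx)
      (hxy ▸ 𝒞.mem_part hy))
    (η := 1 / P.card) (by positivity) hsearch (u := L) (v := Real.log P.card)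
    (by linarith) (by linarith) (by nlinarith [hln.space]) (E := L ^ 2 * 𝒞.parts.card)
    (F := 2 / √ℓ) (by positivity) ?_ β
  · refine (fails_mono ?_).trans (hmain.trans (ENNReal.ofReal_le_ofReal ?_))
    · rintro T ⟨hT, hE⟩
      have h1 : (T.card : ℝ) ≤ 𝒞.parts.card + excess 𝒞.part 𝒞.parts T := by
        exact_mod_cast card_le_add_excess 𝒞.parts fun x hx => hI x (hT hx)
      -- Since `2 / 3 ≤ exp (-1 / 3)`, the constant `9` yields `L ^ (-3)`: two powers cancel the
      -- initial `L ^ 2` per cluster and one remains.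
      have h2 : (2 / 3 : ℝ) ^ β ≤ 1 / L ^ 3 := by
        calc (2 / 3 : ℝ) ^ β ≤ Real.exp (-(1 / 3)) ^ β := by
              refine pow_le_pow_left₀ (by norm_num) ?_ _
              linarith [Real.one_sub_le_exp_neg (1 / 3)]
          _ = Real.exp (β * -(1 / 3)) := (Real.exp_nat_mul _ _).symm
          _ ≤ Real.exp (-(3 * Real.log L)) := by
              rw [Real.exp_le_exp]
              linarith
          _ = 1 / L ^ 3 := by
              rw [Real.exp_neg, one_div]
              congr 1
              have := Real.exp_nat_mul (Real.log L) 3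
              rw [Real.exp_log (by linarith)] at this
              exact_mod_cast this
      have h3 : (2 / 3 : ℝ) ^ β * (L ^ 2 * 𝒞.parts.card) ≤ 𝒞.parts.card * (1 / L) := by
        calc (2 / 3 : ℝ) ^ β * (L ^ 2 * 𝒞.parts.card) ≤ 1 / L ^ 3 * (L ^ 2 * 𝒞.parts.card) := by
              gcongr
          _ = 𝒞.parts.card * (1 / L) := by
              field_simp
      have h4 : 3 ≤ L := by linarith [Real.log_le_sub_one_of_pos (x := L) (by linarith)]
      have h5 : 6 * L ≤ L ^ 3 := by nlinarith [mul_pos (show 0 < L by linarith) (show 0 < L by linarith)]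
      linarith
    · refine le_trans ?_ hla.total
      rw [Real.exp_neg, Real.exp_neg, hL, Real.exp_log (by linarith), Real.exp_log (by linarith)]
      have h1 : (P.card : ℝ)⁻¹ ≤ ℓ⁻¹ := inv_anti₀ (by linarith) hℓn
      rw [hL] at hβ2
      calc 2 / √ℓ + β * ((P.card : ℝ)⁻¹ + ℓ⁻¹ + 1 / P.card)
          ≤ 2 / √ℓ + (9 * Real.log (Real.log ℓ) + 1) * (3 * ℓ⁻¹) := by
            gcongr
            · rw [← hL]
              linarith
            · rw [one_div]
              linarith
        _ = _ := by ring
  · refine (fails_mono ?_).trans (hphase.trans (ENNReal.ofReal_le_ofReal ?_))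
    · rintro T ⟨⟨hT1, hT2⟩, -⟩
      refine ⟨hT1, hT2.trans ?_⟩
      gcongr
    · refine hsum.trans ?_
      gcongr

theorem isThetaTilde_self (f : ℝ → ℝ) : IsThetaTilde f f :=
  ⟨0, 1, 1, one_pos, one_pos, Filter.Eventually.of_forall fun x => by simp⟩

theorem exists_pow_half_lt {δ : ℝ} (hδ : 0 < δ) :
    ∃ k : ℕ, (1 / 2 : ℝ) ^ k < δ ∧ ∀ i < k, δ ≤ (1 / 2 : ℝ) ^ i := by
  have h : ∃ k : ℕ, (1 / 2 : ℝ) ^ k < δ := exists_pow_lt_of_lt_one hδ (by norm_num)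
  exact ⟨Nat.find h, Nat.find_spec h, fun i hi => not_lt.1 (Nat.find_min h hi)⟩

end

end KCenter

end

theorem mainTheorem4 :
    ∀ ρ : ℝ, 0 < ρ → ρ < 1 →
    ∃ c : ℝ, 1 < c ∧
    ∀ d : ℕ,
    ∃ ℋ : ℕ → ℝ → PMF (KCenter.Pt d → ℕ),
      (∀ n : ℕ, 2 ≤ n → ∀ s : ℝ, 0 < s →
        KCenter.IsLSH (ℋ n s) s (c * s) ((1 / (n : ℝ)) ^ ρ) (1 / (n : ℝ))) ∧
    ∀ δ σ : ℝ, 0 < δ → δ < 1 → 0 < σ →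
    ∃ (K : KCenter.Consts) (b : ℝ),
    ∀ ω : ℝ, 0 < ω →
    ∃ (κ : ℝ) (c₀ : ℕ) (g h : ℝ → ℝ),
      0 < κ ∧
      KCenter.IsThetaTilde g (fun x => x) ∧
      KCenter.IsThetaTilde h (fun x => x ^ 3) ∧
      ∀ (P : Finset (KCenter.Pt d)) (α : ℕ) (r : ℝ)
        (lst : Finset (KCenter.Pt d) → List (KCenter.Pt d)) (𝒞 : KCenter.Clustering P),
        (∀ x ∈ P, ∀ y ∈ P, x ≠ y → 1 ≤ dist x y) →
        1 ≤ α → α + c₀ ≤ KCenter.logStar P.card →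
        0 < r →
        KCenter.IsListing lst →
        KCenter.IsMinClustering r 𝒞 →
        ω * Real.log P.card ^ b ≤ 𝒞.parts.card →
        1 - 1 / (KCenter.iterLog (α - 1) P.card) ^ κ ≤
          KCenter.prob (KCenter.extKCenter K ρ δ σ c ℋ lst α P r)
            {o | ∃ T : Finset (KCenter.Pt d), o = some T ∧
              (T.card : ℝ) ≤
                𝒞.parts.card * (1 + 1 / g (KCenter.iterLog α P.card)) +
                  h (KCenter.iterLog α P.card)} := by
  intro ρ hρ0 hρ1
  obtain ⟨c, hc, hfam⟩ := KCenter.exists_isLSH hρ0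
  refine ⟨c, hc, fun d => ?_⟩
  obtain ⟨ℋ, hℋ⟩ := hfam d
  refine ⟨ℋ, fun n hn s hs => ?_, fun δ σ hδ0 hδ1 hσ => ?_⟩
  · have hn' : (2 : ℝ) ≤ n := by exact_mod_cast hn
    have h0 : (0 : ℝ) < 1 / n := by positivity
    have h1 : 1 / (n : ℝ) ≤ 1 := by
      rw [div_le_one (by linarith)]
      linarith
    refine ⟨fun x y h => le_trans ?_ ((hℋ n hn s hs).near x y h),
      fun x y h => ((hℋ n hn s hs).far x y h).trans ?_⟩
    · exact Real.rpow_le_rpow_of_exponent_ge h0 h1 (by linarith)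
    · exact pow_le_of_le_one h0.le h1 two_ne_zero
  obtain ⟨k₀, hk₀, hk₀'⟩ := KCenter.exists_pow_half_lt hδ0
  -- The first summand covers the losses in the first `k₀` rounds; the second makes the initial
  -- sampling of later subphases rich enough relative to the local space.
  set kP : ℝ := 4 * 4 ^ k₀ + 4 / σ with hkPdef
  have hkP : 0 < kP := by positivity
  have hkP1 : 4 * 4 ^ k₀ ≤ kP := by
    have : 0 < 4 / σ := by positivity
    linarith
  have hkP2 : 4 ≤ σ * kP := by
    have h1 : σ * kP = σ * (4 * 4 ^ k₀) + 4 := by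
      rw [hkPdef]
      field_simp
    have h2 : 0 < σ * (4 * 4 ^ k₀) := by positivity
    linarith
  refine ⟨⟨kP, 1 / Real.log 2, 1, 9, 1, 1, hkP, one_div_pos.2 (Real.log_pos (by norm_num)),
    one_pos, by norm_num, one_pos, one_pos⟩, 1, fun ω hω => ?_⟩
  obtain ⟨M, hM⟩ := Filter.eventually_atTop.1
    (KCenter.eventually_isLarge d hρ0 hδ0 hσ hω hkP (sub_pos.2 hk₀))
  obtain ⟨m, hm⟩ := exists_nat_ge (max M 1)
  -- The offset `m + 1` forces every iterated logarithm up to order `α` above the largeness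
  -- threshold. The additive term `6 * L` lies below `L ^ 3`, so the functions `x` and `x ^ 3`
  -- themselves serve.
  refine ⟨1 / 4, m + 1, fun x => x, fun x => x ^ 3, by norm_num, KCenter.isThetaTilde_self _,
    KCenter.isThetaTilde_self _, ?_⟩
  intro P α r lst 𝒞 hsep hα hstar hr hl h𝒞 hω𝒞
  have hge : ∀ j ≤ α, (m : ℝ) + 1 ≤ KCenter.iterLog j P.card := fun j hj =>
    KCenter.le_iterLog_of_add_le_logStar (by omega)
  have hpos : ∀ j ≤ α, 1 < KCenter.iterLog j P.card := fun j hj => by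
    linarith [hge j hj, (le_max_right M 1).trans hm]
  have hlarge : ∀ j ≤ α, KCenter.IsLarge d ρ δ σ ω kP (δ - (1 / 2) ^ k₀)
      (KCenter.iterLog j P.card) := fun j hj =>
    hM _ (by linarith [hge j hj, (le_max_left M 1).trans hm])
  rw [Real.rpow_one] at hω𝒞
  refine KCenter.prob_univ_sub _ _ ?_ ?_
  · have := hpos (α - 1) (by omega)
    positivity
  refine le_trans (MeasureTheory.measure_mono ?_) (KCenter.extKCenter_fails_le hl hc hδ1 hσ hω hr
    rfl rfl rfl hk₀' hkP1 hkP2 hlarge hpos (fun Q hQ H hHQ hH => KCenter.mkEnv_search hl hc hρ0 hρ1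
      rfl rfl (hlarge 0 (Nat.zero_le _)) hℋ hsep hQ hHQ hH) h𝒞.1 hω𝒞 hα)
  intro o ho T hoT hT
  exact ho ⟨T, hoT, hT⟩
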